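/- **Setting.** Let $T=(N,E)$, $E\subseteq N\times N$, be a directed tree with an at most countable node set $N$ and root $0\in N$: for every node $i$ there is exactly one directed path from $0$ to $i$ (there are no directed cycles and no edge enters $0$). Let $\deg(i)\in\mathbb N_0\cup\{\infty\}$ be the number of nodes adjacent to $i$ and let $L=\{k\in N\setminus\{0\}:\deg(k)=1\}$ be the set of leaves. Let $P=\{\ell_1,\ell_2,\dots\}\subseteq N\setminus\{0\}$ with $(0,\ell_1),(\ell_1,\ell_2),\dots\in E$ be a path that either ends at a leaf or is infinite, and let $k^*$ be a child of the root, $(0,k^*)\in E$, with $k^*\notin P$ whenever $\deg(0)\ge 2$. A family $X=(X_n)_{n\in N}$ of real random variables is *Markov tree distributed* with respect to $T$ if, for all finite disjoint $A,B\subset N$ and every $i\in N$ that is an inner node of the undirected path between $a$ and $b$ for all $a\in A$, $b\in B$, the vectors $(X_j)_{j\in A}$ and $(X_j)_{j\in B}$ are conditionally independent given $X_i$. We write $V\uparrow_{st}U$ if the conditional distribution of $V$ given $U=u$ is increasing in $u$ in the usual stochastic order, outside a null set of the distribution of $U$. A function $f:\mathbb R^d\to\mathbb R$ is supermodular if $f(x)+f(y)\le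 f(x\wedge y)+f(x\vee y)$ for all $x,y$. A *weight* is a measurable $b:\mathbb R^d\to[1,\infty)$ such that $b(y)\le b(x)$ whenever every $y_i$ lies between $0$ and $x_i$ (for instance $b\equiv1$ or $b(x)=\max\{1,\|x\|^p\}$). For random vectors, $V\le_{sm}W$ means $\mathbb E f(V)\le\mathbb E f(W)$ for every measurable supermodular $f$ for which there is a weight $b$ with $\mathbb E\,b(V)<\infty$, $\mathbb E\,b(W)<\infty$ and $\sup_x|f(x)|/b(x)<\infty$. For families indexed by $N$, $V\le_{sm}W$ means $(V_{n_1},\dots,V_{n_m})\le_{sm}(W_{n_1},\dots,W_{n_m})$ for all $m$ and all $n_1,\dots,n_m\in N$. A vector or family $V$ is *positive supermodular dependent* (PSMD) if $V^\perp\le_{sm}V$, where $V^\perp$ has independent components with the same marginal distributions as $V$. **Theorem.** Let $X=(X_n)_{n\in N}$ and $Y=(Y_n)_{n\in N}$ be Markov tree distributed with respect to $T$. Assume for all $(i,j)\in E$ that 1. $X_j\uparrow_{st}X_i$ if $j\ne k^*$; 2. $Y_i\uparrow_{st}Y_j$ if $j\notin L$, and $Y_j\uparrow_{st}Y_i$ if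 $j\notin P$. Then the following hold. - If $(X_i,X_j)\le_{sm}(Y_i,Y_j)$ for all $(i,j)\in E$, then $X\le_{sm}Y$. - If $(X_i,X_j)\ge_{sm}(Y_i,Y_j)$ for all $(i,j)\in E$, then $X\ge_{sm}Y$. - If $(X_0,X_{k^*})$ is PSMD, then $X$ is PSMD. - If $(Y_i,Y_j)$ is PSMD for every $(i,j)\in E$ with $j\in P\cap L$, then $Y$ is PSMD. -/

import Mathlib

open MeasureTheory ProbabilityTheory

noncomputable section

namespace MarkovTree

/-- A directed tree (arborescence) on the node set `N`: from the root to every node there is exactly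
one directed path, given by its list of nodes. For the root itself this is the list `[root]`, so
there are no directed cycles and no edge enters the root. -/
structure DirTree (N : Type*) where
  root : N
  E : N → N → Prop
  existsUnique_path : ∀ i : N, ∃! p : List N,
    p.IsChain E ∧ p.head? = some root ∧ p.getLast? = some i

namespace DirTree

variable {N : Type*} (T : DirTree N)

/-- The number of nodes adjacent to `i`, possibly infinite. -/
def deg (i : N) : ℕ∞ := {j | T.E i j ∨ T.E j i}.encard

/-- The set of leaves; the root is never a leaf. -/
def leaves : Set N := {k | k ≠ T.root ∧ T.deg k = 1}

/-- The set `P` of nodes, without the root, of a directed path that starts at the root and either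
ends at a leaf or is infinite. -/
def IsRootPath (P : Set N) : Prop :=
  (∃ l : List N, ∃ k ∈ T.leaves,
      (T.root :: l).IsChain T.E ∧ l.getLast? = some k ∧ P = {n | n ∈ l}) ∨
  (∃ l : ℕ → N, T.E T.root (l 0) ∧ (∀ n, T.E (l n) (l (n + 1))) ∧ P = Set.range l)

/-- The underlying undirected graph. -/
def graph : SimpleGraph N := SimpleGraph.fromRel T.E

/-- The node `i` separates `A` and `B`: it is an inner node of the undirected path between `a` and
`b`, for all `a ∈ A` and `b ∈ B`. -/
def Separates (i : N) (A B : Finset N) : Prop :=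
  ∀ a ∈ A, ∀ b ∈ B, i ≠ a ∧ i ≠ b ∧ ∀ w : T.graph.Walk a b, w.IsPath → i ∈ w.support

/-- Markov tree dependence of a distribution `P` on `ℝ^N`, stated for the coordinate process. -/
def IsMarkov [Countable N] (P : Measure (N → ℝ)) [IsFiniteMeasure P] : Prop :=
  ∀ (A B : Finset N) (i : N), Disjoint A B → T.Separates i A B →
    CondIndepFun (MeasurableSpace.comap (fun x : N → ℝ => x i) inferInstance)
      (measurable_pi_apply i).comap_le
      (fun x (j : A) => x j) (fun x (j : B) => x j) P

end DirTree

/-- The stochastic order `ρ ≤_st σ` for distributions on `ℝ`. -/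
def StLE (ρ σ : Measure ℝ) : Prop :=
  ∀ f : ℝ → ℝ, Monotone f → Integrable f ρ → Integrable f σ → ∫ x, f x ∂ρ ≤ ∫ x, f x ∂σ

/-- `V ↑_st U`: the conditional distribution of `V` given `U = u` is `≤_st`-increasing in `u`
outside a null set of the distribution of `U`. -/
def StochIncr {Ω : Type*} [MeasurableSpace Ω] (μ : Measure Ω) [IsFiniteMeasure μ]
    (V U : Ω → ℝ) : Prop :=
  ∃ s : Set ℝ, μ.map U s = 0 ∧ ∀ u ∉ s, ∀ u' ∉ s, u ≤ u' →
    StLE (condDistrib V U μ u) (condDistrib V U μ u')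

/-- Supermodular functions on `ℝ^ι`; `⊓` and `⊔` are taken componentwise. -/
def Supermodular {ι : Type*} (f : (ι → ℝ) → ℝ) : Prop :=
  ∀ x y, f x + f y ≤ f (x ⊓ y) + f (x ⊔ y)

/-- Weight functions `b : ℝ^ι → [1, ∞)`, such as `max {1, ‖x‖ ^ p}`: measurable, and increasing
in each coordinate as that coordinate moves away from `0`. -/
structure IsWeight {ι : Type*} (b : (ι → ℝ) → ℝ) : Prop where
  measurable : Measurable b
  one_le : ∀ x, 1 ≤ b x
  mono : ∀ x y, (∀ i, y i ∈ Set.uIcc 0 (x i)) → b y ≤ b x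

/-- The supermodular order for distributions of random vectors: comparison of the expectations of
all measurable supermodular functions that are `b`-bounded, for any weight `b` that is integrable
under both distributions. -/
def SmLE {ι : Type*} [Finite ι] (P Q : Measure (ι → ℝ)) : Prop :=
  ∀ b : (ι → ℝ) → ℝ, IsWeight b → Integrable b P → Integrable b Q →
    ∀ f : (ι → ℝ) → ℝ, Measurable f → Supermodular f → (∃ C : ℝ, ∀ x, |f x| ≤ C * b x) →
      ∫ x, f x ∂P ≤ ∫ x, f x ∂Q

/-- The supermodular order for distributions of processes: comparison of all finite-dimensional
marginal distributions. -/
def ProcSmLE {N : Type*} (P Q : Measure (N → ℝ)) : Prop :=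
  ∀ (m : ℕ) (n : Fin m → N),
    SmLE (P.map fun x (k : Fin m) => x (n k)) (Q.map fun x (k : Fin m) => x (n k))

section RandomVariables

variable {N Ω : Type*} [MeasurableSpace Ω]

/-- The law of the family `X` on `ℝ^N`. -/
def law (μ : Measure Ω) (X : N → Ω → ℝ) : Measure (N → ℝ) := μ.map fun ω n => X n ω

instance (μ : Measure Ω) [IsFiniteMeasure μ] (X : N → Ω → ℝ) : IsFiniteMeasure (law μ X) := by
  unfold law; infer_instance

/-- The law on `ℝ^N` of a family of independent variables with the same marginals as `X`. -/
def indepLaw (μ : Measure Ω) (X : N → Ω → ℝ) : Measure (N → ℝ) :=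
  Measure.infinitePi fun n => μ.map (X n)

/-- Positive supermodular dependence of a random vector. -/
def PSMD [Finite N] (μ : Measure Ω) (X : N → Ω → ℝ) : Prop := SmLE (indepLaw μ X) (law μ X)

/-- Positive supermodular dependence of a process. -/
def ProcPSMD (μ : Measure Ω) (X : N → Ω → ℝ) : Prop := ProcSmLE (indepLaw μ X) (law μ X)

end RandomVariables

end MarkovTree

end

/-!
Let `P`, `Q` be the laws of `X`, `Y`. By dominated convergence along truncations it is enough to
compare the integrals of a bounded supermodular function `f` of the nodes in a finite subtree. Let
`j` be a leaf of this subtree and `i` its parent, and let `R f` be `f` with the coordinate `x_j`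
integrated out against the conditional law of `X_j` given `X_i = x_i` under `P`. Since `X_j` is
stochastically increasing in `X_i`, the function `R f` is again supermodular, and it does not depend
on `x_j`. As `E_P R f = E_P f`, this gives
`E_Q f - E_P f = (E_Q R f - E_P R f) + (E_Q f - E_Q R f)`.
The first bracket is the same problem on a smaller subtree, until only the edge `(0, k*)` is left.
In the second one the remaining nodes can be integrated out one by one in the direction of the edge
`(i, j)`, each against its conditional law under `Q` given its neighbour in this direction. This
commutes with `R` and leaves a supermodular function `g` of `x_i` and `x_j`, so the second bracket
is `E_Q g - E_Q R g = E_Q g - E_P g`, a difference for a single edge. The leaf `j` is chosen below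
all nodes of the given path that lie in the subtree: then no node of the path has to be integrated
out given its parent, which is where the monotonicity of `Y` may fail.

A conditional law that is increasing only off a null set is first replaced by a kernel that is
increasing everywhere and differs from it on a set of small measure.

For positive dependence, compare with independent variables, which are Markov tree distributed and
stochastically increasing in each other; a stochastically increasing pair is positively supermodular
dependent by a Chebyshev-type argument.
-/

namespace MarkovTree

namespace DirTree

variable {N : Type*} (T : DirTree N)

/-- The directed path from the root to `i`, as the list of its nodes. -/
noncomputable def path (i : N) : List N := (T.existsUnique_path i).choose

/-- The number of nodes on the directed path from the root to `i`; the root has depth one. -/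
noncomputable def depth (i : N) : ℕ := (T.path i).length

/-- The ancestor order: there is a directed path from `i` to `j`. Every node is its own ancestor. -/
def Anc (i j : N) : Prop := Relation.ReflTransGen T.E i j

variable {T} {a b c i j k l : N} {S : Finset N}

theorem path_spec (i : N) :
    (T.path i).IsChain T.E ∧ (T.path i).head? = some T.root ∧ (T.path i).getLast? = some i :=
  (T.existsUnique_path i).choose_spec.1

theorem path_unique {p : List N} (h : p.IsChain T.E) (hh : p.head? = some T.root)
    (hl : p.getLast? = some i) : p = T.path i :=
  (T.existsUnique_path i).unique ⟨h, hh, hl⟩ (path_spec i)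

theorem path_child (h : T.E i j) : T.path j = T.path i ++ [j] := by
  obtain ⟨hchain, hhead, hlast⟩ := T.path_spec i
  refine (path_unique ?_ ?_ (by simp)).symm
  · refine hchain.append (List.isChain_singleton j) fun x hx y hy => ?_
    rw [hlast] at hx
    simp only [List.head?_cons, Option.mem_def, Option.some.injEq] at hx hy
    rwa [← hx, ← hy]
  · rw [List.head?_append, hhead]
    rfl

theorem depth_child (h : T.E i j) : T.depth j = T.depth i + 1 := by
  simp [depth, path_child h]

theorem edge_ne (h : T.E i j) : i ≠ j := by
  rintro rfl
  have := depth_child h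
  omega

theorem parent_unique (h : T.E i k) (h' : T.E j k) : i = j := by
  have hpath : T.path i = T.path j :=
    List.append_cancel_right ((path_child h).symm.trans (path_child h'))
  exact Option.some_injective _ ((path_spec i).2.2.symm.trans (hpath ▸ (path_spec j).2.2))

theorem not_edge_root (i : N) : ¬ T.E i T.root := by
  intro h
  have hroot : [T.root] = T.path T.root := path_unique (List.isChain_singleton _) rfl rfl
  have hnil : T.path i = [] := by simpa [path_child h] using congrArg List.length hroot
  simpa [hnil] using (T.path_spec i).2.1

theorem exists_parent (hj : j ≠ T.root) : ∃ i, T.E i j := by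
  obtain ⟨hchain, hhead, hlast⟩ := T.path_spec j
  obtain ⟨p, hp⟩ := List.getLast?_eq_some_iff.1 hlast
  rw [hp] at hchain hhead
  rcases List.eq_nil_or_concat p with rfl | ⟨q, i, rfl⟩
  · exact absurd (by simpa using hhead) hj
  · rw [List.isChain_append] at hchain
    exact ⟨i, hchain.2.2 i (by simp) j (by simp)⟩

theorem Anc.refl (i : N) : T.Anc i i := Relation.ReflTransGen.refl

theorem Anc.trans (h : T.Anc a b) (h' : T.Anc b c) : T.Anc a c := Relation.ReflTransGen.trans h h'

theorem Anc.child (h : T.Anc a i) (hij : T.E i j) : T.Anc a j := Relation.ReflTransGen.tail h hij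

instance : Std.Refl T.Anc := ⟨Anc.refl⟩

instance : IsTrans N T.Anc := ⟨fun _ _ _ => Anc.trans⟩

theorem anc_root (j : N) : T.Anc T.root j := by
  induction h : T.depth j using Nat.strong_induction_on generalizing j with
  | _ n ih =>
    by_cases hj : j = T.root
    · exact hj ▸ .refl j
    · obtain ⟨i, hi⟩ := exists_parent hj
      exact (ih (T.depth i) (by rw [← h, depth_child hi]; omega) i rfl).child hi

theorem Anc.eq_or_parent (h : T.Anc a j) (hij : T.E i j) : a = j ∨ T.Anc a i := by
  rcases Relation.ReflTransGen.cases_tail h with h | ⟨c, hc, hcj⟩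
  · exact .inl h.symm
  · exact .inr (parent_unique hij hcj ▸ hc)

theorem Anc.eq_or_child (h : T.Anc a j) : a = j ∨ ∃ c, T.E a c ∧ T.Anc c j :=
  Relation.ReflTransGen.cases_head h

theorem Anc.depth_le (h : T.Anc a b) : T.depth a ≤ T.depth b := by
  induction h with
  | refl => exact le_rfl
  | tail _ h ih => rw [depth_child h]; omega

theorem Anc.eq_of_depth_le (h : T.Anc a b) (hd : T.depth b ≤ T.depth a) : a = b := by
  rcases h.eq_or_child with h | ⟨c, hc, hcb⟩
  · exact h
  · have := depth_child hc
    have := hcb.depth_le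
    omega

theorem not_anc_of_edge (h : T.E i j) : ¬ T.Anc j i := fun h' => by
  have := h'.depth_le
  have := depth_child h
  omega

theorem Anc.total (ha : T.Anc a j) (hb : T.Anc b j) : T.Anc a b ∨ T.Anc b a := by
  induction ha with
  | refl => exact .inr hb
  | tail hac hcj ih =>
    rcases hb.eq_or_parent hcj with rfl | h
    · exact .inl (Anc.child hac hcj)
    · exact ih h

theorem finite_setOf_anc (j : N) : {a | T.Anc a j}.Finite := by
  have h : T.Anc T.root j := anc_root j
  induction h with
  | refl =>
    refine (Set.finite_singleton T.root).subset fun a ha => ?_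
    exact Anc.eq_of_depth_le ha (anc_root a).depth_le
  | @tail b c _ hbc ih => exact (ih.insert c).subset fun a ha => Anc.eq_or_parent ha hbc

theorem anc_of_deg_root (hk : T.E T.root k) (hdeg : ¬ 2 ≤ T.deg T.root) (hj : j ≠ T.root) :
    T.Anc k j := by
  rcases (anc_root j).eq_or_child with h | ⟨c, hc, hcj⟩
  · exact absurd h.symm hj
  · have hck : c = k := by
      by_contra hne
      refine hdeg ?_
      rw [deg, ← Set.encard_pair hne]
      exact Set.encard_le_encard (Set.pair_subset (.inl hc) (.inl hk))
    exact hck ▸ hcj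

theorem notMem_leaves_of_edge (hij : T.E i j) (hjk : T.E j k) : j ∉ T.leaves := by
  rintro ⟨-, hdeg⟩
  have hik : i = k := Set.encard_le_one_iff.1 hdeg.le i k (.inr hij) (.inl hjk)
  exact not_anc_of_edge hij ((Anc.refl j).child (hik ▸ hjk))

theorem notMem_leaves_of_anc (hij : T.E i j) (hab : T.E a b) (hbi : T.Anc b i) : b ∉ T.leaves := by
  rcases hbi.eq_or_child with rfl | ⟨c, hbc, -⟩
  · exact notMem_leaves_of_edge hab hij
  · exact notMem_leaves_of_edge hab hbc

theorem IsRootPath.isChain {R : Set N} (hR : T.IsRootPath R) : IsChain T.Anc R := by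
  rcases hR with ⟨p, -, -, hp, -, rfl⟩ | ⟨p, -, hp, rfl⟩
  · have hpair : p.Pairwise T.Anc :=
      (List.isChain_iff_pairwise.1 (hp.imp fun _ _ => (Anc.refl _).child)).of_cons
    have : Std.Symm fun a b => T.Anc a b ∨ T.Anc b a := ⟨fun _ _ => Or.symm⟩
    exact (hpair.imp fun h => Or.inl h).set_pairwise
  · have hmono (m n : ℕ) (hmn : m ≤ n) : T.Anc (p m) (p n) := by
      induction n, hmn using Nat.le_induction with
      | base => exact .refl _
      | succ n _ ih => exact ih.child (hp n)
    rintro - ⟨m, rfl⟩ - ⟨n, rfl⟩ -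
    exact (le_total m n).imp (hmono m n) (hmono n m)

theorem Separates.symm {A B : Finset N} (h : T.Separates i A B) : T.Separates i B A :=
  fun b hb a ha =>
    have ⟨hia, hib, hw⟩ := h a ha b hb
    ⟨hib, hia, fun w hpath => by simpa using hw w.reverse hpath.reverse⟩

theorem mem_support_of_walk (hij : T.E i j) (w : T.graph.Walk a b) (ha : T.Anc j a)
    (hb : ¬ T.Anc j b) : i ∈ w.support ∧ j ∈ w.support := by
  induction w with
  | nil => exact absurd ha hb
  | @cons a c b hac w ih =>
    by_cases hc : T.Anc j c
    · exact (ih hc hb).imp (List.mem_cons_of_mem _) (List.mem_cons_of_mem _)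
    · rw [graph, SimpleGraph.fromRel_adj] at hac
      rcases hac.2 with hac | hca
      · exact absurd (ha.child hac) hc
      · rcases ha.eq_or_parent hca with rfl | hjc
        · simp [parent_unique hij hca]
        · exact absurd hjc hc

variable (T) in
/-- The node `l` hangs off the rest of `S` at `l'`: it is separated by `l'` from all other nodes
of `S`. -/
structure IsPendant [DecidableEq N] (S : Finset N) (l l' : N) : Prop where
  mem : l ∈ S
  attached_mem : l' ∈ S
  ne : l' ≠ l
  separates : T.Separates l' {l} (S \ {l', l})

variable (T) in
/-- With each of its nodes, `S` contains the parent of that node. -/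
def ParentClosed (S : Finset N) : Prop := ∀ i j, T.E i j → j ∈ S → i ∈ S

variable (T) in
/-- With each of its nodes, `S` contains the next node on the undirected path to `i`: this is the
parent, unless the node is an ancestor of `i`. -/
structure ClosedToward (i : N) (S : Finset N) : Prop where
  parent_mem : ∀ a b, T.E a b → b ∈ S → ¬ T.Anc b i → a ∈ S
  child_mem : ∀ a b, T.E a b → a ∈ S → T.Anc b i → b ∈ S

theorem ParentClosed.mem_of_anc (hS : T.ParentClosed S) (h : T.Anc a b) (hb : b ∈ S) : a ∈ S := by
  induction h with
  | refl => exact hb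
  | tail _ hcd ih => exact ih (hS _ _ hcd hb)

theorem ParentClosed.closedToward (hS : T.ParentClosed S) (hi : i ∈ S) : T.ClosedToward i S where
  parent_mem a b hab hb _ := hS a b hab hb
  child_mem _ _ _ _ hb := hS.mem_of_anc hb hi

theorem exists_parentClosed (F : Finset N) : ∃ S : Finset N, F ⊆ S ∧ T.ParentClosed S := by
  have hfin : (⋃ j ∈ F, {a | T.Anc a j}).Finite :=
    F.finite_toSet.biUnion fun j _ => finite_setOf_anc j
  refine ⟨hfin.toFinset, fun j hj => ?_, fun i j hij hj => ?_⟩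
  · simpa only [Set.Finite.mem_toFinset, Set.mem_iUnion₂] using ⟨j, hj, Anc.refl j⟩
  · simp only [Set.Finite.mem_toFinset, Set.mem_iUnion₂] at hj ⊢
    obtain ⟨n, hn, hjn⟩ := hj
    exact ⟨n, hn, ((Anc.refl i).child hij).trans hjn⟩

theorem exists_greatest_of_isChain {R : Set N} (hR : IsChain T.Anc R) (hRS : ∃ p ∈ R, p ∈ S) :
    ∃ m ∈ R, m ∈ S ∧ ∀ p ∈ R, p ∈ S → T.Anc p m := by
  classical
  obtain ⟨m, hm, hmax⟩ := (S.filter (· ∈ R)).exists_max_image T.depth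
    (hRS.imp fun p hp => Finset.mem_filter.2 hp.symm)
  simp only [Finset.mem_filter, and_imp] at hm hmax
  refine ⟨m, hm.2, hm.1, fun p hp hpS => ?_⟩
  rcases hR.total hp hm.2 with h | h
  · exact h
  · exact h.eq_of_depth_le (hmax p hpS hp) ▸ .refl _

theorem exists_leaf_below_chain {R : Set N} (hR : IsChain T.Anc R) (hk : T.E T.root k)
    (hkR : 2 ≤ T.deg T.root → k ∉ R) (hne : ∃ q ∈ S, q ≠ T.root ∧ q ≠ k) :
    ∃ j ∈ S, j ≠ T.root ∧ j ≠ k ∧ (∀ c, T.E j c → c ∉ S) ∧ ∀ p ∈ R, p ∈ S → T.Anc p j := by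
  classical
  obtain ⟨q, hqS, hq, hqR⟩ : ∃ q ∈ S, (q ≠ T.root ∧ q ≠ k) ∧ ∀ p ∈ R, p ∈ S → T.Anc p q := by
    obtain ⟨q, hqS, hq⟩ := hne
    by_cases hRS : ∃ p ∈ R, p ∈ S
    · obtain ⟨m, hmR, hmS, hm⟩ := exists_greatest_of_isChain hR hRS
      by_cases hm' : m ≠ T.root ∧ m ≠ k
      · exact ⟨m, hmS, hm', hm⟩
      suffices hmq : T.Anc m q from ⟨q, hqS, hq, fun p hp hpS => (hm p hp hpS).trans hmq⟩
      rw [not_and_or, not_not, not_not] at hm'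
      rcases hm' with rfl | rfl
      · exact anc_root q
      · exact anc_of_deg_root hk (fun hdeg => hkR hdeg hmR) hq.1
    · exact ⟨q, hqS, hq, fun p hp hpS => absurd ⟨p, hp, hpS⟩ hRS⟩
  obtain ⟨j, hj, hmax⟩ := (S.filter fun q => (q ≠ T.root ∧ q ≠ k) ∧
    ∀ p ∈ R, p ∈ S → T.Anc p q).exists_max_image T.depth
      ⟨q, Finset.mem_filter.2 ⟨hqS, hq, hqR⟩⟩
  simp only [Finset.mem_filter, and_imp] at hj hmax
  obtain ⟨hjS, ⟨hjroot, hjk⟩, hjR⟩ := hj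
  refine ⟨j, hjS, hjroot, hjk, fun c hjc hcS => ?_, hjR⟩
  have hcroot : c ≠ T.root := fun h => not_edge_root j (h ▸ hjc)
  have hck : c ≠ k := fun h => hjroot (parent_unique (h ▸ hjc) hk)
  have := hmax c hcS hcroot hck fun p hp hpS => (hjR p hp hpS).child hjc
  have := depth_child hjc
  omega

variable [DecidableEq N]

theorem ParentClosed.erase (hS : T.ParentClosed S) (hj : ∀ c, T.E j c → c ∉ S) :
    T.ParentClosed (S.erase j) := by
  intro a b hab hb
  rw [Finset.mem_erase] at hb ⊢
  exact ⟨fun h => hj b (h ▸ hab) hb.2, hS a b hab hb.2⟩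

theorem isPendant_child (hij : T.E i j) (hi : i ∈ S) (hj : j ∈ S)
    (hS : ∀ b ∈ S, T.Anc j b → b = j) : T.IsPendant S j i where
  mem := hj
  attached_mem := hi
  ne := edge_ne hij
  separates := by
    intro a ha b hb
    obtain rfl := Finset.mem_singleton.1 ha
    simp only [Finset.mem_sdiff, Finset.mem_insert, Finset.mem_singleton, not_or] at hb
    exact ⟨edge_ne hij, Ne.symm hb.2.1, fun w _ =>
      (mem_support_of_walk hij w (.refl _) fun h => hb.2.2 (hS b hb.1 h)).1⟩

theorem isPendant_parent (hij : T.E i j) (hi : i ∈ S) (hj : j ∈ S)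
    (hS : ∀ b ∈ S, b ≠ i → T.Anc j b) : T.IsPendant S i j where
  mem := hi
  attached_mem := hj
  ne := (edge_ne hij).symm
  separates := by
    intro a ha b hb
    obtain rfl := Finset.mem_singleton.1 ha
    simp only [Finset.mem_sdiff, Finset.mem_insert, Finset.mem_singleton, not_or] at hb
    refine ⟨(edge_ne hij).symm, Ne.symm hb.2.1, fun w _ => ?_⟩
    simpa using (mem_support_of_walk hij w.reverse (hS b hb.1 hb.2.2) (not_anc_of_edge hij)).2

theorem isPendant_pair (hij : i ≠ j) : T.IsPendant {i, j} j i :=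
  ⟨by simp, by simp, hij, by simp [Separates]⟩

theorem exists_isPendant_child_closedToward (hS : T.ClosedToward i S) (hij : T.E i j)
    (hne : ∃ q ∈ S, q ≠ j ∧ ¬ T.Anc q i) :
    ∃ l l', T.E l' l ∧ ¬ T.Anc l j ∧ T.IsPendant S l l' ∧ T.ClosedToward i (S.erase l) := by
  classical
  obtain ⟨l, hl, hmax⟩ := (S.filter fun q => q ≠ j ∧ ¬ T.Anc q i).exists_max_image T.depth
    (hne.imp fun q hq => Finset.mem_filter.2 hq)
  simp only [Finset.mem_filter, and_imp] at hl hmax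
  obtain ⟨hlS, hlj, hli⟩ := hl
  obtain ⟨l', hl'⟩ := exists_parent fun h : l = T.root => hli (h ▸ anc_root i)
  have hlj' : ¬ T.Anc l j := fun h => (h.eq_or_parent hij).elim hlj hli
  have hbelow (b : N) (hb : b ∈ S) (hlb : T.Anc l b) : b = l := by
    refine (hlb.eq_of_depth_le (hmax b hb ?_ fun h => hli (hlb.trans h))).symm
    rintro rfl
    exact hlj' hlb
  refine ⟨l, l', hl', hlj', isPendant_child hl' (hS.parent_mem _ _ hl' hlS hli) hlS hbelow,
    ⟨fun a b hab hb hbi => ?_, fun a b hab ha hbi => ?_⟩⟩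
  · rw [Finset.mem_erase] at hb
    refine Finset.mem_erase.2 ⟨?_, hS.parent_mem a b hab hb.2 hbi⟩
    rintro rfl
    exact hb.1 (hbelow b hb.2 ((Anc.refl a).child hab))
  · refine Finset.mem_erase.2 ⟨?_, hS.child_mem a b hab (Finset.mem_of_mem_erase ha) hbi⟩
    rintro rfl
    exact hli hbi

theorem exists_isPendant_parent_closedToward (hS : T.ClosedToward i S) (hij : T.E i j)
    (hne : ∃ q ∈ S, q ≠ i ∧ q ≠ j) (hanc : ∀ q ∈ S, q = j ∨ T.Anc q i) :
    ∃ l l', T.E l l' ∧ T.Anc l' i ∧ T.IsPendant S l l' ∧ T.ClosedToward i (S.erase l) := by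
  obtain ⟨q, hqS, hqi, hqj⟩ := hne
  obtain ⟨l, hlS, hmin⟩ := S.exists_min_image T.depth ⟨q, hqS⟩
  have hlt : T.depth l < T.depth i := (hmin q hqS).trans_lt <| not_le.1 fun h =>
    hqi (((hanc q hqS).resolve_left hqj).eq_of_depth_le h)
  have hlj : l ≠ j := by
    rintro rfl
    have := depth_child hij
    omega
  have hli : l ≠ i := fun h => hlt.ne (congrArg T.depth h)
  obtain ⟨l', hl', hl'i⟩ :=
    (((hanc l hlS).resolve_left hlj).eq_or_child).resolve_left hli
  have hl'S : l' ∈ S := hS.child_mem l l' hl' hlS hl'i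
  refine ⟨l, l', hl', hl'i, isPendant_parent hl' hlS hl'S fun b hb hbl => ?_,
    ⟨fun a b hab hb hbi => ?_, fun a b hab ha hbi => ?_⟩⟩
  · rcases hanc b hb with rfl | hbi
    · exact hl'i.child hij
    · rcases hl'i.total hbi with h | h
      · exact h
      · rcases h.eq_or_parent hl' with rfl | h
        · exact .refl _
        · exact absurd (h.eq_of_depth_le (hmin b hb)) hbl
  · have hbS : b ∈ S := Finset.mem_of_mem_erase hb
    obtain rfl := (hanc b hbS).resolve_right hbi
    exact Finset.mem_erase.2 ⟨parent_unique hab hij ▸ hli.symm, hS.parent_mem a b hab hbS hbi⟩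
  · have haS : a ∈ S := Finset.mem_of_mem_erase ha
    refine Finset.mem_erase.2 ⟨?_, hS.child_mem a b hab haS hbi⟩
    rintro rfl
    have := hmin a haS
    have := depth_child hab
    omega

end DirTree

section Resample

/-- Measurable functions on `ℝ^N` that are bounded by `M` in absolute value and depend on the
coordinates in `S` only. -/
structure BddMeasOn {N : Type*} (M : ℝ) (S : Set N) (f : (N → ℝ) → ℝ) : Prop where
  measurable : Measurable f
  bound : ∀ x, |f x| ≤ M
  dependsOn : DependsOn f S

/-- Resampling of the coordinate `j`: its value is integrated out against the transition kernel `κ`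
started at the value of the coordinate `i`. -/
noncomputable def resample {N : Type*} [DecidableEq N] (κ : Kernel ℝ ℝ) (i j : N)
    (f : (N → ℝ) → ℝ) (x : N → ℝ) : ℝ :=
  ∫ t, f (Function.update x j t) ∂κ (x i)

/-- Kernels on `ℝ` that are increasing in the stochastic order, with no exceptional null set. -/
def MonoKernel (κ : Kernel ℝ ℝ) : Prop := ∀ u u', u ≤ u' → StLE (κ u) (κ u')

variable {N : Type*} {M : ℝ} {S : Set N} {f : (N → ℝ) → ℝ}

theorem BddMeasOn.integrable (hf : BddMeasOn M S f) (P : Measure (N → ℝ)) [IsFiniteMeasure P] :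
    Integrable f P :=
  .of_bound hf.measurable.aestronglyMeasurable M (ae_of_all _ hf.bound)

theorem BddMeasOn.mono {S' : Set N} (hf : BddMeasOn M S f) (h : S ⊆ S') : BddMeasOn M S' f :=
  ⟨hf.measurable, hf.bound, hf.dependsOn.mono h⟩

theorem BddMeasOn.nonneg (hf : BddMeasOn M S f) : 0 ≤ M :=
  (abs_nonneg _).trans (hf.bound 0)

theorem BddMeasOn.integral_eq_of_map_eq {i : N} (hf : BddMeasOn M {i} f)
    {P Q : Measure (N → ℝ)} (h : (P.map fun x => x i) = Q.map fun x => x i) :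
    ∫ x, f x ∂P = ∫ x, f x ∂Q := by
  classical
  have hg : Measurable fun t => f (Function.update 0 i t) :=
    hf.measurable.comp (measurable_update 0)
  have hfg (ρ : Measure (N → ℝ)) :
      ∫ x, f x ∂ρ = ∫ t, f (Function.update 0 i t) ∂ρ.map fun x => x i := by
    rw [integral_map (measurable_pi_apply i).aemeasurable hg.aestronglyMeasurable]
    refine integral_congr_ae (ae_of_all _ fun x => hf.dependsOn fun n hn => ?_)
    rw [Set.mem_singleton_iff.1 hn, Function.update_self]
  rw [hfg, hfg, h]

variable [DecidableEq N] {κ : Kernel ℝ ℝ}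

theorem BddMeasOn.integrable_update (hf : BddMeasOn M S f) (x : N → ℝ) (j : N) (ρ : Measure ℝ)
    [IsFiniteMeasure ρ] : Integrable (fun t => f (Function.update x j t)) ρ :=
  .of_bound (hf.measurable.comp (measurable_update x)).aestronglyMeasurable M
    (ae_of_all _ fun _ => hf.bound _)

theorem measurable_resample [IsSFiniteKernel κ] (hf : Measurable f) (i j : N) :
    Measurable (resample κ i j f) :=
  ((hf.comp measurable_update').stronglyMeasurable.integral_kernel_prod_right'
    (κ := κ.comap (fun x : N → ℝ => x i) (measurable_pi_apply i))).measurable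

theorem abs_resample_le [IsMarkovKernel κ] (hf : ∀ x, |f x| ≤ M) (i j : N) (x : N → ℝ) :
    |resample κ i j f x| ≤ M := by
  simpa [resample] using norm_integral_le_of_norm_le_const (μ := κ (x i)) (C := M)
    (f := fun t => f (Function.update x j t)) (ae_of_all _ fun _ => hf _)

theorem dependsOn_resample (hf : DependsOn f S) (i j : N) :
    DependsOn (resample κ i j f) (insert i (S \ {j})) := by
  intro x y hxy
  have hi : x i = y i := hxy i (Set.mem_insert _ _)
  simp only [resample, hi]
  congr 1 with t
  refine hf fun n hn => ?_
  rcases eq_or_ne n j with rfl | h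
  · simp
  · simpa [Function.update_of_ne h] using hxy n (Or.inr ⟨hn, h⟩)

theorem BddMeasOn.resample [IsMarkovKernel κ] (hf : BddMeasOn M S f) (i j : N) :
    BddMeasOn M (insert i (S \ {j})) (resample κ i j f) :=
  ⟨measurable_resample hf.measurable i j, abs_resample_le hf.bound i j,
    dependsOn_resample hf.dependsOn i j⟩

theorem update_inf_update (x y : N → ℝ) (j : N) (s t : ℝ) :
    Function.update x j s ⊓ Function.update y j t = Function.update (x ⊓ y) j (s ⊓ t) := by
  ext n
  rcases eq_or_ne n j with rfl | h
  · simp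
  · simp [Function.update_of_ne h]

theorem update_sup_update (x y : N → ℝ) (j : N) (s t : ℝ) :
    Function.update x j s ⊔ Function.update y j t = Function.update (x ⊔ y) j (s ⊔ t) := by
  ext n
  rcases eq_or_ne n j with rfl | h
  · simp
  · simp [Function.update_of_ne h]

theorem Supermodular.monotone_update_sub (hf : Supermodular f) {x y : N → ℝ} (hxy : x ≤ y) (j : N) :
    Monotone fun t => f (Function.update y j t) - f (Function.update x j t) := by
  intro s t hst
  have h := hf (Function.update y j s) (Function.update x j t)
  rw [update_inf_update, update_sup_update, inf_eq_right.2 hxy, sup_eq_left.2 hxy,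
    inf_eq_left.2 hst, sup_eq_right.2 hst] at h
  simp only
  linarith

theorem MonoKernel.supermodular_resample [IsFiniteKernel κ] (hκ : MonoKernel κ)
    (hf : BddMeasOn M S f) (hs : Supermodular f) (i j : N) :
    Supermodular (resample κ i j f) := by
  suffices key : ∀ x y : N → ℝ, x i ≤ y i →
      resample κ i j f x + resample κ i j f y ≤
        resample κ i j f (x ⊓ y) + resample κ i j f (x ⊔ y) by
    intro x y
    rcases le_total (x i) (y i) with h | h
    · exact key x y h
    · rw [add_comm, inf_comm, sup_comm]
      exact key y x h
  intro x y hxy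
  have hinf : (x ⊓ y) i = x i := inf_eq_left.2 hxy
  have hsup : (x ⊔ y) i = y i := sup_eq_right.2 hxy
  simp only [resample, hinf, hsup]
  have I (z : N → ℝ) (u : ℝ) := hf.integrable_update z j (κ u)
  have hle : ∫ t, (f (Function.update (x ⊔ y) j t) - f (Function.update y j t)) ∂κ (x i) ≤
      ∫ t, (f (Function.update (x ⊔ y) j t) - f (Function.update y j t)) ∂κ (y i) :=
    hκ _ _ hxy _ (hs.monotone_update_sub le_sup_right j) ((I _ _).sub (I _ _))
      ((I _ _).sub (I _ _))
  have hsm : ∫ t, (f (Function.update x j t) + f (Function.update y j t)) ∂κ (x i) ≤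
      ∫ t, (f (Function.update (x ⊓ y) j t) + f (Function.update (x ⊔ y) j t)) ∂κ (x i) := by
    refine integral_mono ((I _ _).add (I _ _)) ((I _ _).add (I _ _)) fun t => ?_
    simpa only [update_inf_update, update_sup_update, inf_idem, sup_idem] using
      hs (Function.update x j t) (Function.update y j t)
  rw [integral_sub (I _ _) (I _ _), integral_sub (I _ _) (I _ _)] at hle
  rw [integral_add (I _ _) (I _ _), integral_add (I _ _) (I _ _)] at hsm
  linarith

theorem resample_comm {κ' : Kernel ℝ ℝ} [IsFiniteKernel κ] [IsFiniteKernel κ']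
    (hf : BddMeasOn M S f) {i j i' j' : N} (hjj' : j ≠ j') (hij' : i ≠ j') (hi'j : i' ≠ j) :
    resample κ i j (resample κ' i' j' f) = resample κ' i' j' (resample κ i j f) := by
  ext x
  simp only [resample, Function.update_of_ne hij', Function.update_of_ne hi'j]
  rw [integral_integral_swap]
  · simp only [Function.update_comm hjj']
  · refine .of_bound (C := M) (Measurable.aestronglyMeasurable ?_)
      (ae_of_all _ fun _ => hf.bound _)
    exact hf.measurable.comp (measurable_update'.comp
      (((measurable_update x).comp measurable_fst).prodMk measurable_snd))

end Resample

section MonotoneKernels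

theorem exists_monotone_retraction {α : Type*} [ConditionallyCompleteLinearOrder α]
    [TopologicalSpace α] [OrderTopology α] {K : Set α} (hK : IsCompact K) (hne : K.Nonempty) :
    ∃ r : α → α, Monotone r ∧ (∀ x, r x ∈ K) ∧ ∀ x ∈ K, r x = x := by
  let s (x : α) : Set α := K ∩ Set.Iic (max x (sInf K))
  have hs_ne (x : α) : (s x).Nonempty := ⟨sInf K, hK.sInf_mem hne, le_max_right _ _⟩
  have hs (x : α) : IsCompact (s x) := hK.inter_right isClosed_Iic
  refine ⟨fun x => sSup (s x), fun x y hxy => ?_, fun x => ((hs x).sSup_mem (hs_ne x)).1,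
    fun x hx => ?_⟩
  · exact csSup_le_csSup (hs y).bddAbove (hs_ne x)
      (Set.inter_subset_inter_right _ (Set.Iic_subset_Iic.2 (max_le_max hxy le_rfl)))
  · have hmax : max x (sInf K) = x := max_eq_left (csInf_le hK.bddBelow hx)
    exact IsGreatest.csSup_eq ⟨⟨hx, hmax.ge⟩, fun y hy => hy.2.trans hmax.le⟩

theorem StochIncr.exists_monoKernel {Ω : Type*} [MeasurableSpace Ω] {μ : Measure Ω}
    [IsProbabilityMeasure μ] {V U : Ω → ℝ} (hU : AEMeasurable U μ) (h : StochIncr μ V U)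
    {ε : ℝ} (hε : 0 < ε) :
    ∃ κ : Kernel ℝ ℝ, IsMarkovKernel κ ∧ MonoKernel κ ∧
      (μ.map U).real {u | κ u ≠ condDistrib V U μ u} ≤ ε := by
  obtain ⟨s, hs, hmono⟩ := h
  have := Measure.isProbabilityMeasure_map hU
  set m := μ.map U
  obtain ⟨u₀, hu₀⟩ : ∃ u₀, u₀ ∉ s := (measure_eq_zero_iff_ae_notMem.1 hs).exists
  have hnull : m (toMeasurable m s) = 0 := by rw [measure_toMeasurable, hs]
  -- The kernel is kept on a compact set of almost full measure and made monotone by precomposition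
  -- with a monotone retraction onto this set; `u₀` is added to make the set nonempty.
  obtain ⟨K, hKs, hK, hKε⟩ := (measurableSet_toMeasurable m s).compl.exists_isCompact_sdiff_lt
    (measure_ne_top m _) (ENNReal.ofReal_pos.2 hε).ne'
  obtain ⟨r, hr, hrK, hrid⟩ := exists_monotone_retraction (hK.insert u₀) (Set.insert_nonempty _ _)
  have hrs (u : ℝ) : r u ∉ s := by
    rcases hrK u with h | h
    · rwa [h]
    · exact fun hu => hKs h (subset_toMeasurable m s hu)
  refine ⟨(condDistrib V U μ).comap r hr.measurable, inferInstance,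
    fun u u' huu' => hmono _ (hrs u) _ (hrs u') (hr huu'), ENNReal.toReal_le_of_le_ofReal hε.le ?_⟩
  calc m {u | (condDistrib V U μ).comap r hr.measurable u ≠ condDistrib V U μ u}
      ≤ m (toMeasurable m s ∪ (toMeasurable m s)ᶜ \ K) := by
        refine measure_mono fun u hu => ?_
        by_contra hu'
        have huK : u ∈ K := not_not.1 fun h => hu' (Or.inr ⟨fun h' => hu' (Or.inl h'), h⟩)
        exact hu (by rw [Kernel.comap_apply, hrid u (Or.inr huK)])
    _ ≤ m (toMeasurable m s) + m ((toMeasurable m s)ᶜ \ K) := measure_union_le _ _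
    _ ≤ ENNReal.ofReal ε := by rw [hnull, zero_add]; exact hKε.le

theorem abs_integral_resample_sub_le {N : Type*} [DecidableEq N] {P : Measure (N → ℝ)}
    [IsProbabilityMeasure P] {M ε : ℝ} {S : Set N} {f : (N → ℝ) → ℝ} (hf : BddMeasOn M S f)
    {κ κ' : Kernel ℝ ℝ} [IsMarkovKernel κ] [IsMarkovKernel κ'] {i : N} (j : N)
    (hε : (P.map fun x => x i).real {u | κ u ≠ κ' u} ≤ ε) :
    |∫ x, resample κ i j f x ∂P - ∫ x, resample κ' i j f x ∂P| ≤ 2 * M * ε := by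
  set A := toMeasurable (P.map fun x => x i) {u | κ u ≠ κ' u}
  have hA : MeasurableSet A := measurableSet_toMeasurable _ _
  have hAi : MeasurableSet ((fun x : N → ℝ => x i) ⁻¹' A) := measurable_pi_apply i hA
  have h : BddMeasOn M _ (resample κ i j f) := hf.resample i j
  have h' : BddMeasOn M _ (resample κ' i j f) := hf.resample i j
  rw [← integral_sub (h.integrable P) (h'.integrable P)]
  calc |∫ x, (resample κ i j f x - resample κ' i j f x) ∂P|
      ≤ ∫ x, |resample κ i j f x - resample κ' i j f x| ∂P := abs_integral_le_integral_abs
    _ ≤ ∫ x, ((fun x : N → ℝ => x i) ⁻¹' A).indicator (fun _ => 2 * M) x ∂P := by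
        refine integral_mono ((h.integrable P).sub (h'.integrable P)).abs
          ((integrable_const _).indicator hAi) fun x => ?_
        by_cases hx : x ∈ (fun x : N → ℝ => x i) ⁻¹' A
        · rw [Set.indicator_of_mem hx, two_mul]
          exact (abs_sub _ _).trans (add_le_add (h.bound x) (h'.bound x))
        · have hκ : κ (x i) = κ' (x i) := by
            by_contra hne
            exact hx (subset_toMeasurable _ _ hne)
          rw [Set.indicator_of_notMem hx]
          simp [resample, hκ]
    _ = 2 * M * (P.map fun x => x i).real {u | κ u ≠ κ' u} := by
        rw [integral_indicator_const _ hAi,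
          ← map_measureReal_apply (measurable_pi_apply i) hA, smul_eq_mul, mul_comm,
          measureReal_def, measure_toMeasurable, measureReal_def]
    _ ≤ 2 * M * ε := by
        gcongr
        exact mul_nonneg zero_le_two hf.nonneg

theorem StochIncr.exists_monoKernel_abs_integral_resample_sub_le {N : Type*} [DecidableEq N]
    {P : Measure (N → ℝ)} [IsProbabilityMeasure P] {i j : N}
    (h : StochIncr P (fun x => x j) (fun x => x i)) (M : ℝ) {ε : ℝ} (hε : 0 < ε) :
    ∃ κ : Kernel ℝ ℝ, IsMarkovKernel κ ∧ MonoKernel κ ∧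
      ∀ (Q : Measure (N → ℝ)) [IsProbabilityMeasure Q],
        (Q.map fun x => x i) = (P.map fun x => x i) → ∀ (S : Set N) (f : (N → ℝ) → ℝ),
        BddMeasOn M S f → |∫ x, resample κ i j f x ∂Q -
          ∫ x, resample (condDistrib (fun x => x j) (fun x => x i) P) i j f x ∂Q| ≤ ε := by
  have hM : 0 < 2 * |M| + 1 := by positivity
  obtain ⟨κ, hκ, hmono, hle⟩ := h.exists_monoKernel (measurable_pi_apply i).aemeasurable
    (div_pos hε hM)
  refine ⟨κ, hκ, hmono, fun Q _ hQ S f hf => ?_⟩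
  rw [← hQ] at hle
  refine (abs_integral_resample_sub_le hf j hle).trans ?_
  rw [mul_div_assoc', div_le_iff₀ hM, mul_comm]
  exact mul_le_mul_of_nonneg_left (by linarith [le_abs_self M]) hε.le

end MonotoneKernels

section ConditionalIndependence

theorem integral_integral_condDistrib_of_condIndepFun {Ω α β γ E : Type*} {mΩ : MeasurableSpace Ω}
    [StandardBorelSpace Ω] {mα : MeasurableSpace α} {mβ : MeasurableSpace β}
    [StandardBorelSpace β] [Nonempty β] {mγ : MeasurableSpace γ} [StandardBorelSpace γ] [Nonempty γ]
    [NormedAddCommGroup E] [NormedSpace ℝ E] {μ : Measure Ω} [IsFiniteMeasure μ]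
    {U : Ω → α} {G : Ω → β} {V : Ω → γ} (hU : Measurable U) (hG : Measurable G) (hV : Measurable V)
    (h : G ⟂ᵢ[U, hU; μ] V) {F : (α × β) × γ → E} (hF : StronglyMeasurable F)
    (hint : Integrable (fun ω => F ((U ω, G ω), V ω)) μ) :
    ∫ ω, ∫ t, F ((U ω, G ω), t) ∂condDistrib V U μ (U ω) ∂μ = ∫ ω, F ((U ω, G ω), V ω) ∂μ := by
  have hUG : Measurable fun ω => (U ω, G ω) := hU.prodMk hG
  have hlaw : μ.map (fun ω => ((U ω, G ω), V ω)) =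
      μ.map (fun ω => (U ω, G ω)) ⊗ₘ (condDistrib V U μ).prodMkRight β :=
    (condDistrib_ae_eq_iff_measure_eq_compProd _ hV.aemeasurable _).1
      ((condIndepFun_iff_condDistrib_prod_ae_eq_prodMkRight hV hG hU).1 h)
  have hint' : Integrable F (μ.map fun ω => ((U ω, G ω), V ω)) :=
    (integrable_map_measure hF.aestronglyMeasurable (hUG.prodMk hV).aemeasurable).2 hint
  rw [← integral_map (hUG.prodMk hV).aemeasurable hF.aestronglyMeasurable, hlaw,
    Measure.integral_compProd (hlaw ▸ hint'), integral_map hUG.aemeasurable]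
  · rfl
  · exact hF.integral_kernel_prod_right'.aestronglyMeasurable

theorem DirTree.IsPendant.integral_resample {N : Type*} [Countable N] [DecidableEq N]
    {T : DirTree N} {S : Finset N} {i j : N} (hS : T.IsPendant S j i) {P : Measure (N → ℝ)}
    [IsFiniteMeasure P] (hP : T.IsMarkov P) {M : ℝ} {f : (N → ℝ) → ℝ} (hf : BddMeasOn M S f) :
    ∫ x, resample (condDistrib (fun x => x j) (fun x => x i) P) i j f x ∂P = ∫ x, f x ∂P := by
  set B := S \ {i, j}
  have hB : Measurable fun (x : N → ℝ) (b : B) => x b :=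
    measurable_pi_lambda _ fun b => measurable_pi_apply _
  have hci := (hP B {j} i (by simp [B]) hS.separates.symm).comp measurable_id
    (measurable_pi_apply ⟨j, Finset.mem_singleton_self j⟩)
  let F (p : (ℝ × (B → ℝ)) × ℝ) : ℝ :=
    f (Function.update (Function.updateFinset (Function.update 0 i p.1.1) B p.1.2) j p.2)
  have hF : Measurable F := hf.measurable.comp <| measurable_update'.comp <|
    (measurable_updateFinset'.comp
      (((measurable_update 0).comp measurable_fst.fst).prodMk measurable_fst.snd)).prodMk
        measurable_snd
  have hfF (x : N → ℝ) (t : ℝ) :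
      f (Function.update x j t) = F ((x i, fun b : B => x b), t) := by
    refine hf.dependsOn fun n hn => ?_
    by_cases hnj : n = j
    · simp [hnj]
    · by_cases hni : n = i
      · simp [hni, Function.updateFinset, B, hS.ne]
      · have : n ∈ B := by simp [B, hni, hnj, Finset.mem_coe.1 hn]
        simp [Function.update_of_ne hnj, Function.updateFinset, this]
  have hfF' (x : N → ℝ) : f x = F ((x i, fun b : B => x b), x j) := by
    rw [← hfF, Function.update_eq_self]
  simp only [resample, hfF]
  rw [integral_congr_ae (ae_of_all _ hfF')]
  refine integral_integral_condDistrib_of_condIndepFun (measurable_pi_apply i) hB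
    (measurable_pi_apply j) hci hF.stronglyMeasurable ?_
  exact (hf.integrable P).congr (ae_of_all _ hfF')

end ConditionalIndependence

section Reduction

variable {N : Type*} [DecidableEq N] {M : ℝ} {f : (N → ℝ) → ℝ} {Q : Measure (N → ℝ)}
  {κ : Kernel ℝ ℝ} {i j : N} {S : Finset N}

/-- Up to an arbitrarily small error, a bounded supermodular function of the coordinates in `S` can
be replaced by one of the coordinates `i` and `j` only, both in its expectation under `Q` and in
the one after resampling the coordinate `j` from the coordinate `i` by `κ`. -/
def PairReducible (Q : Measure (N → ℝ)) (κ : Kernel ℝ ℝ) (i j : N) (S : Finset N) : Prop :=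
  ∀ (M : ℝ) (f : (N → ℝ) → ℝ), BddMeasOn M S f → Supermodular f → ∀ ε > 0,
    ∃ g, BddMeasOn M {i, j} g ∧ Supermodular g ∧ |∫ x, f x ∂Q - ∫ x, g x ∂Q| ≤ ε ∧
      |∫ x, resample κ i j f x ∂Q - ∫ x, resample κ i j g x ∂Q| ≤ ε

theorem pairReducible_of_subset (h : (S : Set N) ⊆ {i, j}) : PairReducible Q κ i j S :=
  fun _ f hf hs ε hε => ⟨f, hf.mono h, hs, by simpa using hε.le, by simpa using hε.le⟩

theorem BddMeasOn.resample_erase [IsMarkovKernel κ] (hf : BddMeasOn M S f) (hi : i ∈ S)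
    (hij : i ≠ j) : BddMeasOn M (S.erase j) (MarkovTree.resample κ i j f) :=
  (hf.resample i j).mono (by simp [hi, hij])

variable [Countable N] {T : DirTree N} [IsProbabilityMeasure Q]

theorem PairReducible.of_erase [IsMarkovKernel κ] (hQ : T.IsMarkov Q) {l l' : N}
    (hS : T.IsPendant S l l') (hi : i ∈ S) (hli : l ≠ i) (hlj : l ≠ j) (hl'j : l' ≠ j)
    (hsi : StochIncr Q (fun x => x l) (fun x => x l')) (h : PairReducible Q κ i j (S.erase l)) :
    PairReducible Q κ i j S := by
  intro M f hf hs ε hε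
  obtain ⟨κ', _, hmono, hκ'⟩ :=
    hsi.exists_monoKernel_abs_integral_resample_sub_le M (half_pos hε)
  have hclose (f : (N → ℝ) → ℝ) (hf : BddMeasOn M S f) :
      |∫ x, f x ∂Q - ∫ x, resample κ' l' l f x ∂Q| ≤ ε / 2 := by
    rw [← hS.integral_resample hQ hf, abs_sub_comm]
    exact hκ' Q rfl S f hf
  obtain ⟨g, hg, hgs, hfg, hfg'⟩ := h M _ (hf.resample_erase hS.attached_mem hS.ne)
    (hmono.supermodular_resample hf hs l' l) _ (half_pos hε)
  refine ⟨g, hg, hgs, ?_, ?_⟩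
  · have := (abs_sub_le _ _ _).trans (add_le_add (hclose f hf) hfg)
    rwa [add_halves] at this
  · have hfj : BddMeasOn M S (resample κ i j f) :=
      (hf.resample i j).mono (Set.insert_subset hi Set.sdiff_subset)
    have hclose' := hclose _ hfj
    rw [resample_comm hf hlj hl'j hli.symm] at hclose'
    have := (abs_sub_le _ _ _).trans (add_le_add hclose' hfg')
    rwa [add_halves] at this

open DirTree in
theorem pairReducible_of_closedToward [IsMarkovKernel κ] (hQ : T.IsMarkov Q) (hij : T.E i j)
    (hS : T.ClosedToward i S) (hi : i ∈ S) (hj : ∀ c, T.E j c → c ∉ S)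
    (hup : ∀ a b, T.E a b → T.Anc b i → StochIncr Q (fun x => x a) (fun x => x b))
    (hdown : ∀ a b, T.E a b → b ∈ S → ¬ T.Anc b j → StochIncr Q (fun x => x b) (fun x => x a)) :
    PairReducible Q κ i j S := by
  induction S using Finset.strongInduction with
  | H S ih =>
    have hreduce (l l' : N) (hl : T.IsPendant S l l') (hli : l ≠ i) (hlj : l ≠ j) (hl'j : l' ≠ j)
        (hcl : T.ClosedToward i (S.erase l))
        (hsi : StochIncr Q (fun x => x l) (fun x => x l')) : PairReducible Q κ i j S :=
      .of_erase hQ hl hi hli hlj hl'j hsi <| ih _ (Finset.erase_ssubset hl.mem) hcl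
        (Finset.mem_erase.2 ⟨hli.symm, hi⟩) (fun c hc h => hj c hc (Finset.mem_of_mem_erase h))
        fun a b hab hb => hdown a b hab (Finset.mem_of_mem_erase hb)
    by_cases hpair : (S : Set N) ⊆ {i, j}
    · exact pairReducible_of_subset hpair
    -- First the nodes that are not ancestors of `i` are removed, starting with the deepest ones,
    -- then the proper ancestors of `i`, starting at the top.
    by_cases hbelow : ∃ q ∈ S, q ≠ j ∧ ¬ T.Anc q i
    · obtain ⟨l, l', hl', hlj, hl, hcl⟩ := exists_isPendant_child_closedToward hS hij hbelow
      refine hreduce l l' hl ?_ ?_ ?_ hcl (hdown l' l hl' hl.mem hlj)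
      · exact fun h => hlj (h ▸ (Anc.refl i).child hij)
      · rintro rfl
        exact hlj (.refl l)
      · exact fun h => hj l (h ▸ hl') hl.mem
    · have hanc (q : N) (hq : q ∈ S) : q = j ∨ T.Anc q i := by
        by_contra! h
        exact hbelow ⟨q, hq, h⟩
      have hne : ∃ q ∈ S, q ≠ i ∧ q ≠ j := by
        simpa [Set.not_subset] using hpair
      obtain ⟨l, l', hl', hl'i, hl, hcl⟩ :=
        exists_isPendant_parent_closedToward hS hij hne hanc
      refine hreduce l l' hl ?_ ?_ ?_ hcl (hup l l' hl' hl'i)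
      · exact fun h => not_anc_of_edge hl' (h ▸ hl'i)
      · exact fun h => not_anc_of_edge hij (((Anc.refl j).child (h ▸ hl')).trans hl'i)
      · exact fun h => not_anc_of_edge hij (h ▸ hl'i)

end Reduction

section Comparison

variable {N : Type*} [Countable N]

/-- The assumptions of the theorem on the laws `P` of `X` and `Q` of `Y`, apart from the comparison
of the pairs of adjacent nodes. The chain `R` takes the place of the path `P` there. -/
structure Comparable (T : DirTree N) (R : Set N) (k : N) (P Q : Measure (N → ℝ))
    [IsFiniteMeasure P] [IsFiniteMeasure Q] : Prop where
  isChain : IsChain T.Anc R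
  edge_root : T.E T.root k
  notMem : 2 ≤ T.deg T.root → k ∉ R
  markov_left : T.IsMarkov P
  markov_right : T.IsMarkov Q
  down_left : ∀ i j, T.E i j → j ≠ k → StochIncr P (fun x => x j) (fun x => x i)
  up_right : ∀ i j, T.E i j → j ∉ T.leaves → StochIncr Q (fun x => x i) (fun x => x j)
  down_right : ∀ i j, T.E i j → j ∉ R → StochIncr Q (fun x => x j) (fun x => x i)

variable {T : DirTree N} {R : Set N} {k i j : N} {P Q : Measure (N → ℝ)}
  [IsProbabilityMeasure P] [IsProbabilityMeasure Q] {S : Finset N} {M : ℝ} {f : (N → ℝ) → ℝ}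

open DirTree

theorem Comparable.pairReducible [DecidableEq N] (h : Comparable T R k P Q) {κ : Kernel ℝ ℝ}
    [IsMarkovKernel κ] (hS : T.ParentClosed S) (hij : T.E i j) (hjS : j ∈ S)
    (hj : ∀ c, T.E j c → c ∉ S) (hjR : ∀ p ∈ R, p ∈ S → T.Anc p j) : PairReducible Q κ i j S :=
  pairReducible_of_closedToward h.markov_right hij (hS.closedToward (hS i j hij hjS))
    (hS i j hij hjS) hj (fun a b hab hbi => h.up_right a b hab (notMem_leaves_of_anc hij hab hbi))
    fun a b hab hb hbj => h.down_right a b hab fun hbR => hbj (hjR b hbR hb)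

theorem Comparable.exists_approx_split [DecidableEq N] (h : Comparable T R k P Q)
    (hS : T.ParentClosed S) (hij : T.E i j) (hjS : j ∈ S) (hjk : j ≠ k) (hj : ∀ c, T.E j c → c ∉ S)
    (hjR : ∀ p ∈ R, p ∈ S → T.Anc p j) (hmarg : (P.map fun x => x i) = Q.map fun x => x i)
    (hf : BddMeasOn M S f) (hs : Supermodular f) {ε : ℝ} (hε : 0 < ε) :
    ∃ f' g, BddMeasOn M (S.erase j) f' ∧ Supermodular f' ∧ BddMeasOn M {i, j} g ∧
      Supermodular g ∧ |(∫ x, f x ∂Q - ∫ x, f x ∂P) -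
        ((∫ x, f' x ∂Q - ∫ x, f' x ∂P) + (∫ x, g x ∂Q - ∫ x, g x ∂P))| ≤ ε := by
  have hi : i ∈ S := hS i j hij hjS
  have hleaf : T.IsPendant S j i := isPendant_child hij hi hjS fun b hb hjb =>
    (hjb.eq_or_child.resolve_right fun ⟨c, hc, hcb⟩ => hj c hc (hS.mem_of_anc hcb hb)).symm
  set κ := condDistrib (fun x : N → ℝ => x j) (fun x => x i) P
  obtain ⟨κ', _, hmono, hκ'⟩ :=
    (h.down_left i j hij hjk).exists_monoKernel_abs_integral_resample_sub_le M
      (show 0 < ε / 4 by positivity)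
  obtain ⟨g, hg, hgs, hfg, hfg'⟩ :=
    h.pairReducible (κ := κ) hS hij hjS hj hjR M f hf hs (ε / 4) (by positivity)
  have hfP : |∫ x, resample κ' i j f x ∂P - ∫ x, f x ∂P| ≤ ε / 4 := by
    rw [← hleaf.integral_resample h.markov_left hf]
    exact hκ' P rfl S f hf
  have hfQ := hκ' Q hmarg.symm S f hf
  have hgP : ∫ x, resample κ i j g x ∂Q = ∫ x, g x ∂P := by
    have hres : BddMeasOn M {i} (resample κ i j g) := (hg.resample i j).mono (by
      rintro q (rfl | ⟨rfl | rfl, hq⟩)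
      exacts [rfl, rfl, absurd rfl hq])
    rw [← hres.integral_eq_of_map_eq hmarg]
    exact (isPendant_pair (edge_ne hij)).integral_resample h.markov_left
      (by rwa [Finset.coe_pair])
  rw [hgP] at hfg'
  refine ⟨resample κ' i j f, g, hf.resample_erase hi (edge_ne hij),
    hmono.supermodular_resample hf hs i j, hg, hgs, ?_⟩
  rw [abs_le] at *
  constructor <;> linarith

/-- Taking `K = [0, ∞)` and `K = (-∞, 0]` gives the comparison in the two directions. -/
theorem Comparable.integral_sub_integral_mem_of_parentClosed (h : Comparable T R k P Q)
    (hmarg : ∀ i j, T.E i j → (P.map fun x => x i) = Q.map fun x => x i)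
    {K : AddSubmonoid ℝ} (hK : IsClosed (K : Set ℝ))
    (hpair : ∀ i j, T.E i j → ∀ M g, BddMeasOn M {i, j} g → Supermodular g →
      ∫ x, g x ∂Q - ∫ x, g x ∂P ∈ K)
    (hS : T.ParentClosed S) (hkS : k ∈ S) (hf : BddMeasOn M S f) (hs : Supermodular f) :
    ∫ x, f x ∂Q - ∫ x, f x ∂P ∈ K := by
  classical
  induction S using Finset.strongInduction generalizing f with
  | H S ih =>
    by_cases hall : (S : Set N) ⊆ {T.root, k}
    · exact hpair _ _ h.edge_root M f (hf.mono hall) hs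
    obtain ⟨j, hjS, hjroot, hjk, hj, hjR⟩ := exists_leaf_below_chain (S := S) h.isChain h.edge_root
      h.notMem (by simpa [Set.not_subset] using hall)
    obtain ⟨i, hij⟩ := exists_parent hjroot
    rw [← SetLike.mem_coe, ← hK.closure_eq, Metric.mem_closure_iff]
    intro ε hε
    obtain ⟨f', g, hf', hfs', hg, hgs, hle⟩ := h.exists_approx_split hS hij hjS hjk hj hjR
      (hmarg i j hij) hf hs (half_pos hε)
    exact ⟨_, K.add_mem (ih _ (Finset.erase_ssubset hjS) (hS.erase hj)
      (Finset.mem_erase.2 ⟨hjk.symm, hkS⟩) hf' hfs') (hpair i j hij M g hg hgs),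
      hle.trans_lt (half_lt_self hε)⟩

theorem Comparable.integral_sub_integral_mem (h : Comparable T R k P Q)
    (hmarg : ∀ i j, T.E i j → (P.map fun x => x i) = Q.map fun x => x i)
    {K : AddSubmonoid ℝ} (hK : IsClosed (K : Set ℝ))
    (hpair : ∀ i j, T.E i j → ∀ M g, BddMeasOn M {i, j} g → Supermodular g →
      ∫ x, g x ∂Q - ∫ x, g x ∂P ∈ K)
    (hf : BddMeasOn M S f) (hs : Supermodular f) :
    ∫ x, f x ∂Q - ∫ x, f x ∂P ∈ K := by
  classical
  obtain ⟨S', hSS', hS'⟩ := exists_parentClosed (T := T) (insert k S)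
  rw [Finset.insert_subset_iff] at hSS'
  exact h.integral_sub_integral_mem_of_parentClosed hmarg hK hpair hS' hSS'.1
    (hf.mono (Finset.coe_subset.2 hSS'.2)) hs

end Comparison

section SupermodularOrder

open Filter

variable {ι : Type*}

/-- Componentwise truncation to `[-c, c]`. -/
def truncate (c : ℝ) (x : ι → ℝ) : ι → ℝ := fun i => max (-c) (min c (x i))

theorem measurable_truncate (c : ℝ) : Measurable (truncate c : (ι → ℝ) → ι → ℝ) :=
  measurable_pi_lambda _ fun i =>
    measurable_const.max (measurable_const.min (measurable_pi_apply i))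

theorem truncate_inf (c : ℝ) (x y : ι → ℝ) : truncate c (x ⊓ y) = truncate c x ⊓ truncate c y := by
  ext i
  simp only [truncate, Pi.inf_apply]
  rw [inf_inf_distrib_left, sup_inf_left]

theorem truncate_sup (c : ℝ) (x y : ι → ℝ) : truncate c (x ⊔ y) = truncate c x ⊔ truncate c y := by
  ext i
  simp only [truncate, Pi.sup_apply]
  rw [inf_sup_left, sup_sup_distrib_left]

theorem eventually_truncate_eq [Finite ι] (x : ι → ℝ) :
    ∀ᶠ n : ℕ in atTop, truncate n x = x := by
  have h : ∀ᶠ n : ℕ in atTop, ∀ i, |x i| ≤ n :=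
    eventually_all.2 fun i => tendsto_natCast_atTop_atTop.eventually_ge_atTop |x i|
  filter_upwards [h] with n hn
  ext i
  rw [truncate, min_eq_right (abs_le.1 (hn i)).2, max_eq_right (abs_le.1 (hn i)).1]

theorem IsWeight.truncate_le {b : (ι → ℝ) → ℝ} (hb : IsWeight b) {c : ℝ} (hc : 0 ≤ c) (x : ι → ℝ) :
    b (truncate c x) ≤ b x := by
  refine hb.mono _ _ fun i => ?_
  rw [truncate, Set.mem_uIcc]
  grind

theorem IsWeight.exists_truncate_le [Finite ι] {b : (ι → ℝ) → ℝ} (hb : IsWeight b) {c : ℝ}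
    (hc : 0 ≤ c) : ∃ B, ∀ x, b (truncate c x) ≤ B := by
  obtain ⟨B, hB⟩ := (Set.finite_range fun s : ι → Bool => b fun i => if s i then c else -c).bddAbove
  refine ⟨B, fun x => (hb.mono (fun i => if decide (0 ≤ x i) then c else -c) _ fun i => ?_).trans
    (hB ⟨fun i => decide (0 ≤ x i), rfl⟩)⟩
  rw [truncate, Set.mem_uIcc]
  grind

theorem IsWeight.tendsto_integral_truncate [Finite ι] {b : (ι → ℝ) → ℝ} (hb : IsWeight b)
    {P : Measure (ι → ℝ)} (hbP : Integrable b P) {f : (ι → ℝ) → ℝ} (hf : Measurable f) {C : ℝ}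
    (hC : 0 ≤ C) (hfb : ∀ x, |f x| ≤ C * b x) :
    Tendsto (fun n : ℕ => ∫ x, f (truncate n x) ∂P) atTop (nhds (∫ x, f x ∂P)) := by
  refine tendsto_integral_of_dominated_convergence (fun x => C * b x)
    (fun n => (hf.comp (measurable_truncate n)).aestronglyMeasurable) (hbP.const_mul C)
    (fun n => ae_of_all _ fun x => ?_) (ae_of_all _ fun x => ?_)
  · exact (hfb _).trans (mul_le_mul_of_nonneg_left (hb.truncate_le n.cast_nonneg x) hC)
  · exact tendsto_const_nhds.congr' ((eventually_truncate_eq x).mono fun n hn => congrArg f hn.symm)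

theorem smLE_of_integral_le [Finite ι] {P Q : Measure (ι → ℝ)}
    (h : ∀ M f, BddMeasOn M Set.univ f → Supermodular f → ∫ x, f x ∂P ≤ ∫ x, f x ∂Q) :
    SmLE P Q := by
  rintro b hb hbP hbQ f hf hs ⟨C, hC⟩
  have hC0 : 0 ≤ C := nonneg_of_mul_nonneg_left ((abs_nonneg _).trans (hC 0))
    (zero_lt_one.trans_le (hb.one_le 0))
  refine le_of_tendsto_of_tendsto' (hb.tendsto_integral_truncate hbP hf hC0 hC)
    (hb.tendsto_integral_truncate hbQ hf hC0 hC) fun n => ?_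
  obtain ⟨B, hB⟩ := hb.exists_truncate_le (c := n) n.cast_nonneg
  refine h (C * B) _ ⟨hf.comp (measurable_truncate n), fun x => ?_, dependsOn_univ _⟩ fun x y => ?_
  · exact (hC _).trans (mul_le_mul_of_nonneg_left (hB x) hC0)
  · rw [truncate_inf, truncate_sup]
    exact hs _ _

theorem SmLE.integral_le [Finite ι] {P Q : Measure (ι → ℝ)} [IsFiniteMeasure P] [IsFiniteMeasure Q]
    (h : SmLE P Q) {M : ℝ} {S : Set ι} {f : (ι → ℝ) → ℝ} (hf : BddMeasOn M S f)
    (hs : Supermodular f) : ∫ x, f x ∂P ≤ ∫ x, f x ∂Q :=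
  h (fun _ => 1) ⟨measurable_const, fun _ => le_rfl, fun _ _ _ => le_rfl⟩ (integrable_const _)
    (integrable_const _) f hf.measurable hs ⟨M, by simpa using hf.bound⟩

variable {N : Type*} {P Q : Measure (N → ℝ)} {M : ℝ}

theorem measurable_reindex (e : ι → N) : Measurable fun (x : N → ℝ) (k : ι) => x (e k) :=
  measurable_pi_lambda _ fun _ => measurable_pi_apply _

theorem BddMeasOn.reindex {S : Set ι} {f : (ι → ℝ) → ℝ} (hf : BddMeasOn M S f) (e : ι → N) :
    BddMeasOn M (e '' S) fun x => f fun k => x (e k) :=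
  ⟨hf.measurable.comp (measurable_reindex e), fun _ => hf.bound _,
    fun _ _ hxy => hf.dependsOn fun _ hk => hxy _ (Set.mem_image_of_mem e hk)⟩

theorem Supermodular.reindex {f : (ι → ℝ) → ℝ} (hf : Supermodular f) (e : ι → N) :
    Supermodular fun x : N → ℝ => f fun k => x (e k) :=
  fun _ _ => hf _ _

theorem smLE_map_of_integral_le [Finite ι] {e : ι → N}
    (h : ∀ M f, BddMeasOn M (Set.range e) f → Supermodular f → ∫ x, f x ∂P ≤ ∫ x, f x ∂Q) :
    SmLE (P.map fun x k => x (e k)) (Q.map fun x k => x (e k)) := by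
  refine smLE_of_integral_le fun M f hf hs => ?_
  rw [integral_map (measurable_reindex e).aemeasurable hf.measurable.aestronglyMeasurable,
    integral_map (measurable_reindex e).aemeasurable hf.measurable.aestronglyMeasurable]
  exact h M _ (Set.image_univ ▸ hf.reindex e) (hs.reindex e)

theorem SmLE.integral_le_of_map [Finite ι] [Nonempty ι] [IsFiniteMeasure P] [IsFiniteMeasure Q]
    {e : ι → N} (h : SmLE (P.map fun x k => x (e k)) (Q.map fun x k => x (e k)))
    {f : (N → ℝ) → ℝ} (hf : BddMeasOn M (Set.range e) f) (hs : Supermodular f) :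
    ∫ x, f x ∂P ≤ ∫ x, f x ∂Q := by
  have hg := hf.reindex (Function.invFun e)
  have hfg (x : N → ℝ) : f x = f fun n => x (e (Function.invFun e n)) :=
    hf.dependsOn fun n hn => by rw [Function.invFun_eq hn]
  have hle := h.integral_le hg (hs.reindex _)
  rw [integral_map (measurable_reindex e).aemeasurable hg.measurable.aestronglyMeasurable,
    integral_map (measurable_reindex e).aemeasurable hg.measurable.aestronglyMeasurable] at hle
  simpa only [← hfg] using hle

theorem SmLE.map_reindex {κ : Type*} [Finite ι] [Finite κ] {P Q : Measure (κ → ℝ)}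
    [IsFiniteMeasure P] [IsFiniteMeasure Q] (h : SmLE P Q) (e : ι → κ) :
    SmLE (P.map fun x k => x (e k)) (Q.map fun x k => x (e k)) :=
  smLE_map_of_integral_le fun _ _ hf hs => h.integral_le hf hs

theorem supermodular_of_dependsOn_singleton {i : N} {f : (N → ℝ) → ℝ} (hf : DependsOn f {i}) :
    Supermodular f := by
  have hcongr (x y : N → ℝ) (h : x i = y i) : f x = f y :=
    hf fun n hn => by rwa [Set.mem_singleton_iff.1 hn]
  intro x y
  rcases le_total (x i) (y i) with h | h
  · rw [hcongr (x ⊓ y) x (inf_eq_left.2 h), hcongr (x ⊔ y) y (sup_eq_right.2 h)]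
  · rw [hcongr (x ⊓ y) y (inf_eq_right.2 h), hcongr (x ⊔ y) x (sup_eq_left.2 h), add_comm]

theorem map_eval_eq_of_integral_le [IsFiniteMeasure P] [IsFiniteMeasure Q] {i : N}
    (h : ∀ M f, BddMeasOn M {i} f → Supermodular f → ∫ x, f x ∂P ≤ ∫ x, f x ∂Q) :
    (P.map fun x => x i) = Q.map fun x => x i := by
  ext A hA
  have hint (ρ : Measure (N → ℝ)) : ∫ x, A.indicator (1 : ℝ → ℝ) (x i) ∂ρ =
      (ρ.map fun x => x i).real A := by
    rw [← integral_indicator_one hA, integral_map (measurable_pi_apply i).aemeasurable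
      (measurable_one.indicator hA).aestronglyMeasurable]
  have hdep : DependsOn (fun x : N → ℝ => A.indicator (1 : ℝ → ℝ) (x i)) {i} :=
    fun x y hxy => by simp only [hxy i rfl]
  have hdep' : DependsOn (fun x : N → ℝ => -A.indicator (1 : ℝ → ℝ) (x i)) {i} :=
    fun x y hxy => by simp only [hxy i rfl]
  have hmeas : Measurable fun x : N → ℝ => A.indicator (1 : ℝ → ℝ) (x i) :=
    (measurable_one.indicator hA).comp (measurable_pi_apply i)
  have hbound (x : N → ℝ) : |A.indicator (1 : ℝ → ℝ) (x i)| ≤ 1 := by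
    by_cases hx : x i ∈ A <;> simp [hx]
  have hle := h 1 _ ⟨hmeas, hbound, hdep⟩ (supermodular_of_dependsOn_singleton hdep)
  have hge := h 1 (fun x => -A.indicator (1 : ℝ → ℝ) (x i))
    ⟨hmeas.neg, fun x => (abs_neg _).trans_le (hbound x), hdep'⟩
    (supermodular_of_dependsOn_singleton hdep')
  rw [integral_neg, integral_neg, neg_le_neg_iff] at hge
  rw [hint, hint] at hle hge
  exact (measureReal_eq_measureReal_iff (by finiteness) (by finiteness)).1 (hle.antisymm hge)

theorem SmLE.integral_le_of_map_pair [IsFiniteMeasure P] [IsFiniteMeasure Q] {i j : N}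
    (h : SmLE (P.map fun x m => x (![i, j] m)) (Q.map fun x m => x (![i, j] m)))
    {f : (N → ℝ) → ℝ} (hf : BddMeasOn M {i, j} f) (hs : Supermodular f) :
    ∫ x, f x ∂P ≤ ∫ x, f x ∂Q :=
  h.integral_le_of_map (hf.mono (Matrix.range_cons_cons_empty i j _).ge) hs

theorem SmLE.map_eval_eq_of_map_pair [IsFiniteMeasure P] [IsFiniteMeasure Q] {i j : N}
    (h : SmLE (P.map fun x m => x (![i, j] m)) (Q.map fun x m => x (![i, j] m))) :
    (P.map fun x => x i) = Q.map fun x => x i :=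
  map_eval_eq_of_integral_le fun _ _ hf hs => h.integral_le_of_map_pair (hf.mono (by simp)) hs

theorem Comparable.procSmLE [Countable N] [IsProbabilityMeasure P] [IsProbabilityMeasure Q]
    {T : DirTree N} {R : Set N} {k : N} (h : Comparable T R k P Q)
    (hpair : ∀ i j, T.E i j →
      SmLE (P.map fun x m => x (![i, j] m)) (Q.map fun x m => x (![i, j] m))) :
    ProcSmLE P Q := by
  refine fun m n => smLE_map_of_integral_le fun M f hf hs => sub_nonneg.1 ?_
  have hmem := h.integral_sub_integral_mem (K := .nonneg ℝ) (S := (Set.finite_range n).toFinset)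
    (fun i j hij => (hpair i j hij).map_eval_eq_of_map_pair) isClosed_Ici
    (fun i j hij M g hg hs => AddSubmonoid.mem_nonneg.2
      (sub_nonneg.2 ((hpair i j hij).integral_le_of_map_pair hg hs))) (by simpa using hf) hs
  exact AddSubmonoid.mem_nonneg.1 hmem

theorem Comparable.procSmLE_symm [Countable N] [IsProbabilityMeasure P] [IsProbabilityMeasure Q]
    {T : DirTree N} {R : Set N} {k : N} (h : Comparable T R k P Q)
    (hpair : ∀ i j, T.E i j →
      SmLE (Q.map fun x m => x (![i, j] m)) (P.map fun x m => x (![i, j] m))) :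
    ProcSmLE Q P := by
  let K : AddSubmonoid ℝ :=
    ⟨⟨Set.Iic 0, fun ha hb => Set.mem_Iic.2 (add_nonpos ha hb)⟩, Set.self_mem_Iic⟩
  refine fun m n => smLE_map_of_integral_le fun M f hf hs => sub_nonpos.1 ?_
  exact h.integral_sub_integral_mem (K := K) (S := (Set.finite_range n).toFinset)
    (fun i j hij => (hpair i j hij).map_eval_eq_of_map_pair.symm) isClosed_Iic
    (fun i j hij M g hg hs => sub_nonpos.2 ((hpair i j hij).integral_le_of_map_pair hg hs))
    (by simpa using hf) hs

end SupermodularOrder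

section PositiveDependence

theorem integral_comp_prodMk_eq_integral_condDistrib {Ω β γ E : Type*} [MeasurableSpace Ω]
    [MeasurableSpace β] [MeasurableSpace γ] [StandardBorelSpace γ] [Nonempty γ]
    [NormedAddCommGroup E] [NormedSpace ℝ E] {μ : Measure Ω} [IsFiniteMeasure μ] {U : Ω → β}
    {V : Ω → γ} (hU : AEMeasurable U μ) (hV : AEMeasurable V μ) {g : β × γ → E}
    (hg : Integrable g (μ.map fun ω => (U ω, V ω))) :
    ∫ ω, g (U ω, V ω) ∂μ = ∫ u, ∫ v, g (u, v) ∂condDistrib V U μ u ∂μ.map U := by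
  rw [← integral_map (hU.prodMk hV) hg.aestronglyMeasurable, ← compProd_map_condDistrib hV,
    Measure.integral_compProd (by rwa [compProd_map_condDistrib hV])]

theorem integral_prod_le_integral_diag {α : Type*} [MeasurableSpace α] {m : Measure α}
    [IsProbabilityMeasure m] {C : α × α → ℝ} (hC : Integrable C (m.prod m))
    (hdiag : Integrable (fun a => C (a, a)) m)
    (h : ∀ᵐ p ∂m.prod m, C p + C p.swap ≤ C (p.1, p.1) + C (p.2, p.2)) :
    ∫ p, C p ∂m.prod m ≤ ∫ a, C (a, a) ∂m := by
  have hswap : Integrable (fun p => C p.swap) (m.prod m) := hC.swap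
  have hle : ∫ p, (C p + C p.swap) ∂m.prod m ≤ ∫ p, (C (p.1, p.1) + C (p.2, p.2)) ∂m.prod m :=
    integral_mono_ae (hC.add hswap) ((hdiag.comp_fst m).add (hdiag.comp_snd m)) h
  rw [integral_add hC hswap, integral_prod_swap,
    integral_add (hdiag.comp_fst m) (hdiag.comp_snd m),
    integral_fun_fst (μ := m) (ν := m) fun a => C (a, a),
    integral_fun_snd (μ := m) (ν := m) fun a => C (a, a), probReal_univ, one_smul] at hle
  linarith

variable {M : ℝ} {S : Set (Fin 2)} {f : (Fin 2 → ℝ) → ℝ}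

theorem measurable_vec_pair {α : Type*} [MeasurableSpace α] {u v : α → ℝ} (hu : Measurable u)
    (hv : Measurable v) : Measurable fun x => ![u x, v x] :=
  MeasurableEquiv.finTwoArrow.symm.measurable.comp (hu.prodMk hv)

theorem BddMeasOn.integrable_comp_vec {α : Type*} [MeasurableSpace α] (hf : BddMeasOn M S f)
    {u v : α → ℝ} (hu : Measurable u) (hv : Measurable v) (ρ : Measure α) [IsFiniteMeasure ρ] :
    Integrable (fun x => f ![u x, v x]) ρ :=
  .of_bound (hf.measurable.comp (measurable_vec_pair hu hv)).aestronglyMeasurable M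
    (ae_of_all _ fun _ => hf.bound _)

theorem StLE.integral_add_integral_le {ρ σ : Measure ℝ} [IsFiniteMeasure ρ] [IsFiniteMeasure σ]
    (h : StLE ρ σ) (hf : BddMeasOn M S f) (hs : Supermodular f) {a b : ℝ} (hab : a ≤ b) :
    ∫ t, f ![a, t] ∂σ + ∫ t, f ![b, t] ∂ρ ≤ ∫ t, f ![a, t] ∂ρ + ∫ t, f ![b, t] ∂σ := by
  have hupdate (c t : ℝ) : Function.update ![c, 0] 1 t = ![c, t] := by
    ext k
    fin_cases k <;> rfl
  have hle : ![a, 0] ≤ ![b, 0] := fun k => by fin_cases k <;> simp [hab]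
  have hmono : Monotone fun t => f ![b, t] - f ![a, t] := by
    simpa only [hupdate] using hs.monotone_update_sub hle 1
  have I (c : ℝ) (τ : Measure ℝ) [IsFiniteMeasure τ] : Integrable (fun t => f ![c, t]) τ :=
    hf.integrable_comp_vec measurable_const measurable_id τ
  have hint := h _ hmono ((I b ρ).sub (I a ρ)) ((I b σ).sub (I a σ))
  rw [integral_sub (I b ρ) (I a ρ), integral_sub (I b σ) (I a σ)] at hint
  linarith

variable {Ω : Type*} [MeasurableSpace Ω] {μ : Measure Ω} {U V : Ω → ℝ}

theorem integral_law_pair [IsFiniteMeasure μ] (hU : Measurable U) (hV : Measurable V)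
    (hf : BddMeasOn M S f) :
    ∫ x, f x ∂law μ ![U, V] = ∫ a, ∫ t, f ![a, t] ∂condDistrib V U μ a ∂μ.map U := by
  have hvec : (fun ω k => ![U, V] k ω) = fun ω => ![U ω, V ω] := by
    ext ω k
    fin_cases k <;> rfl
  rw [law, hvec, integral_map (measurable_vec_pair hU hV).aemeasurable
    hf.measurable.aestronglyMeasurable]
  exact integral_comp_prodMk_eq_integral_condDistrib (g := fun p => f ![p.1, p.2])
    hU.aemeasurable hV.aemeasurable (hf.integrable_comp_vec measurable_fst measurable_snd _)

theorem integral_indepLaw_pair [IsProbabilityMeasure μ] (hU : Measurable U) (hV : Measurable V)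
    (hf : BddMeasOn M S f) :
    ∫ x, f x ∂indepLaw μ ![U, V] =
      ∫ a, ∫ b, ∫ t, f ![a, t] ∂condDistrib V U μ b ∂μ.map U ∂μ.map U := by
  have := Measure.isProbabilityMeasure_map (μ := μ) hU.aemeasurable
  have := Measure.isProbabilityMeasure_map (μ := μ) hV.aemeasurable
  have hlaw : indepLaw μ ![U, V] =
      ((μ.map U).prod (μ.map V)).map fun p => ![p.1, p.2] := by
    have hmarg : (fun k => μ.map (![U, V] k)) = ![μ.map U, μ.map V] := by
      ext1 k
      fin_cases k <;> rfl
    have (k : Fin 2) : IsProbabilityMeasure (![μ.map U, μ.map V] k) := by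
      fin_cases k <;> assumption
    rw [indepLaw, hmarg, Measure.infinitePi_eq_pi]
    exact ((measurePreserving_finTwoArrow_vec _ _).symm _).map_eq.symm
  rw [hlaw, integral_map (measurable_vec_pair measurable_fst measurable_snd).aemeasurable
    hf.measurable.aestronglyMeasurable,
    integral_prod _ (hf.integrable_comp_vec measurable_fst measurable_snd _)]
  refine integral_congr_ae (ae_of_all _ fun a => ?_)
  have hfa (ρ : Measure (ℝ × ℝ)) [IsFiniteMeasure ρ] : Integrable (fun p => f ![a, p.2]) ρ :=
    hf.integrable_comp_vec measurable_const measurable_snd ρ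
  calc ∫ t, f ![a, t] ∂μ.map V = ∫ ω, f ![a, V ω] ∂μ :=
        integral_map hV.aemeasurable
          (hf.integrable_comp_vec measurable_const measurable_id _).aestronglyMeasurable
    _ = ∫ b, ∫ t, f ![a, t] ∂condDistrib V U μ b ∂μ.map U :=
        integral_comp_prodMk_eq_integral_condDistrib (g := fun p => f ![a, p.2])
          hU.aemeasurable hV.aemeasurable (hfa _)

theorem StochIncr.psmd [IsProbabilityMeasure μ] (h : StochIncr μ V U) (hU : Measurable U)
    (hV : Measurable V) : PSMD μ ![U, V] := by
  obtain ⟨s, hs, hmono⟩ := h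
  refine smLE_of_integral_le fun M f hf hsm => ?_
  set m := μ.map U with hm
  have : IsProbabilityMeasure m := Measure.isProbabilityMeasure_map hU.aemeasurable
  let C (p : ℝ × ℝ) : ℝ := ∫ t, f ![p.1, t] ∂condDistrib V U μ p.2
  have hC : Measurable C := by
    have hmeas : StronglyMeasurable fun q : (ℝ × ℝ) × ℝ => f ![q.1.1, q.2] :=
      (hf.measurable.comp (measurable_vec_pair (measurable_fst.comp measurable_fst)
        measurable_snd)).stronglyMeasurable
    exact (hmeas.integral_kernel_prod_right'
      (κ := (condDistrib V U μ).comap Prod.snd measurable_snd)).measurable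
  have hCM (p : ℝ × ℝ) : ‖C p‖ ≤ M :=
    (norm_integral_le_of_norm_le_const (ae_of_all _ fun _ => hf.bound _)).trans_eq (by simp)
  have hCint : Integrable C (m.prod m) := .of_bound hC.aestronglyMeasurable M (ae_of_all _ hCM)
  have hdiag : Integrable (fun a => C (a, a)) m :=
    .of_bound (hC.comp (measurable_id.prodMk measurable_id)).aestronglyMeasurable M
      (ae_of_all _ fun _ => hCM _)
  have hms : ∀ᵐ a ∂m, a ∉ s := measure_eq_zero_iff_ae_notMem.1 hs
  rw [integral_law_pair hU hV hf, integral_indepLaw_pair hU hV hf, ← hm]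
  refine (integral_prod C hCint).symm.trans_le (integral_prod_le_integral_diag hCint hdiag ?_)
  filter_upwards [Measure.quasiMeasurePreserving_fst.ae hms,
    Measure.quasiMeasurePreserving_snd.ae hms] with p hp₁ hp₂
  rcases le_total p.1 p.2 with hp | hp
  · exact (hmono _ hp₁ _ hp₂ hp).integral_add_integral_le hf hsm hp
  · rw [add_comm, add_comm (C (p.1, p.1))]
    exact (hmono _ hp₂ _ hp₁ hp).integral_add_integral_le hf hsm hp

end PositiveDependence

section Independence

theorem condDistrib_ae_eq_const_of_indepFun {Ω β γ : Type*} [MeasurableSpace Ω]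
    [MeasurableSpace β] [MeasurableSpace γ] [StandardBorelSpace γ] [Nonempty γ] {μ : Measure Ω}
    [IsFiniteMeasure μ] {U : Ω → β} {V : Ω → γ} (hU : AEMeasurable U μ) (hV : AEMeasurable V μ)
    (h : IndepFun U V μ) : condDistrib V U μ =ᵐ[μ.map U] Kernel.const β (μ.map V) := by
  refine condDistrib_ae_eq_of_measure_eq_compProd U hV ?_
  rw [Measure.compProd_const]
  exact (indepFun_iff_map_prod_eq_prod_map_map hU hV).1 h

theorem stochIncr_of_indepFun {Ω : Type*} [MeasurableSpace Ω] {μ : Measure Ω} [IsFiniteMeasure μ]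
    {U V : Ω → ℝ} (hU : AEMeasurable U μ) (hV : AEMeasurable V μ) (h : IndepFun U V μ) :
    StochIncr μ V U := by
  refine ⟨{u | condDistrib V U μ u ≠ μ.map V}, condDistrib_ae_eq_const_of_indepFun hU hV h,
    fun u hu u' hu' _ f _ _ _ => ?_⟩
  rw [not_not.1 hu, not_not.1 hu']

theorem condIndepFun_of_indepFun_prodMk {Ω α β γ : Type*} [MeasurableSpace Ω]
    [StandardBorelSpace Ω] [MeasurableSpace α] [MeasurableSpace β] [StandardBorelSpace β]
    [Nonempty β] [MeasurableSpace γ] [StandardBorelSpace γ] [Nonempty γ] {μ : Measure Ω}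
    [IsFiniteMeasure μ] {U : Ω → α} {G : Ω → β} {V : Ω → γ} (hU : Measurable U) (hG : Measurable G)
    (hV : Measurable V) (h : IndepFun (fun ω => (U ω, G ω)) V μ) : G ⟂ᵢ[U, hU; μ] V := by
  have hUG : Measurable fun ω => (U ω, G ω) := hU.prodMk hG
  refine (condIndepFun_iff_condDistrib_prod_ae_eq_prodMkRight hV hG hU).2 ?_
  have hUV : ∀ᵐ u ∂(μ.map fun ω => (U ω, G ω)).map Prod.fst, condDistrib V U μ u = μ.map V := by
    rw [Measure.map_map measurable_fst hUG]
    exact condDistrib_ae_eq_const_of_indepFun hU.aemeasurable hV.aemeasurable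
      (h.comp measurable_fst measurable_id)
  filter_upwards [condDistrib_ae_eq_const_of_indepFun hUG.aemeasurable hV.aemeasurable h,
    ae_of_ae_map measurable_fst.aemeasurable hUV] with p hp hp'
  rw [hp, Kernel.prodMkRight_apply, hp', Kernel.const_apply]

variable {N : Type*}

theorem stochIncr_of_iIndepFun {P : Measure (N → ℝ)} [IsFiniteMeasure P]
    (h : iIndepFun (fun n (x : N → ℝ) => x n) P) {i j : N} (hij : i ≠ j) :
    StochIncr P (fun x => x j) (fun x => x i) :=
  stochIncr_of_indepFun (measurable_pi_apply i).aemeasurable (measurable_pi_apply j).aemeasurable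
    (h.indepFun hij)

theorem isMarkov_of_iIndepFun [Countable N] (T : DirTree N) {P : Measure (N → ℝ)}
    [IsFiniteMeasure P] (h : iIndepFun (fun n (x : N → ℝ) => x n) P) : T.IsMarkov P := by
  classical
  have hm (n : N) : Measurable fun x : N → ℝ => x n := measurable_pi_apply n
  have hvec (A : Finset N) : Measurable fun (x : N → ℝ) (a : A) => x a :=
    measurable_pi_lambda _ fun a => hm a
  have key (A B : Finset N) (i : N) (hAB : Disjoint A B) (hi : i ∉ B) :
      (fun (x : N → ℝ) (a : A) => x a) ⟂ᵢ[fun x => x i, hm i; P] fun x (b : B) => x b := by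
    refine condIndepFun_of_indepFun_prodMk (hm i) (hvec A) (hvec B) ?_
    have hφ : Measurable fun v : ↥(insert i A) → ℝ =>
        (v ⟨i, Finset.mem_insert_self i A⟩, fun a : A => v ⟨a, Finset.mem_insert_of_mem a.2⟩) := by
      fun_prop
    exact (h.indepFun_finset (insert i A) B (Finset.disjoint_insert_left.2 ⟨hi, hAB⟩) hm).comp hφ
      measurable_id
  intro A B i hAB hsep
  by_cases hi : i ∈ B
  · have hiA : i ∉ A := fun hiA => (hsep i hiA i hi).1 rfl
    exact (key B A i hAB.symm hiA).symm
  · exact key A B i hAB hi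

variable [Countable N] {T : DirTree N} {R : Set N} {k : N} {P Q : Measure (N → ℝ)}
  [IsFiniteMeasure P] [IsFiniteMeasure Q]

theorem Comparable.indep_left (h : Comparable T R k P Q) {P' : Measure (N → ℝ)}
    [IsFiniteMeasure P'] (hP' : iIndepFun (fun n (x : N → ℝ) => x n) P') :
    Comparable T R k P' Q :=
  { h with
    markov_left := isMarkov_of_iIndepFun T hP'
    down_left := fun _ _ hij _ => stochIncr_of_iIndepFun hP' (DirTree.edge_ne hij) }

theorem Comparable.indep_right (h : Comparable T R k P Q) {Q' : Measure (N → ℝ)}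
    [IsFiniteMeasure Q'] (hQ' : iIndepFun (fun n (x : N → ℝ) => x n) Q') :
    Comparable T R k P Q' :=
  { h with
    markov_right := isMarkov_of_iIndepFun T hQ'
    up_right := fun _ _ hij _ => stochIncr_of_iIndepFun hQ' (DirTree.edge_ne hij).symm
    down_right := fun _ _ hij _ => stochIncr_of_iIndepFun hQ' (DirTree.edge_ne hij) }

end Independence

section Laws

variable {N Ω : Type*} [MeasurableSpace Ω] {μ : Measure Ω} {X : N → Ω → ℝ}

theorem isProbabilityMeasure_law [IsProbabilityMeasure μ] (hX : ∀ n, Measurable (X n)) :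
    IsProbabilityMeasure (law μ X) :=
  Measure.isProbabilityMeasure_map (measurable_pi_lambda _ hX).aemeasurable

theorem map_law {β : Type*} [MeasurableSpace β] (hX : ∀ n, Measurable (X n)) {φ : (N → ℝ) → β}
    (hφ : Measurable φ) : (law μ X).map φ = μ.map fun ω => φ fun n => X n ω :=
  Measure.map_map hφ (measurable_pi_lambda _ hX)

theorem stochIncr_law [IsFiniteMeasure μ] (hX : ∀ n, Measurable (X n)) {i j : N}
    (h : StochIncr μ (X j) (X i)) : StochIncr (law μ X) (fun x => x j) (fun x => x i) := by
  rw [StochIncr, condDistrib] at h ⊢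
  simpa only [map_law hX (measurable_pi_apply i),
    map_law hX ((measurable_pi_apply i).prodMk (measurable_pi_apply j))] using h

theorem pair_eq_comp {α : Type*} (x : N → α) (i j : N) : ![x i, x j] = fun k => x (![i, j] k) := by
  ext1 k
  fin_cases k <;> rfl

theorem law_pair (hX : ∀ n, Measurable (X n)) (i j : N) :
    law μ ![X i, X j] = (law μ X).map fun x k => x (![i, j] k) := by
  rw [map_law hX (measurable_reindex _), pair_eq_comp X]
  rfl

variable [IsProbabilityMeasure μ]

theorem indepLaw_pair (hX : ∀ n, Measurable (X n)) {i j : N} (hij : i ≠ j) :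
    indepLaw μ ![X i, X j] = (indepLaw μ X).map fun x k => x (![i, j] k) := by
  have (n : N) : IsProbabilityMeasure (μ.map (X n)) :=
    Measure.isProbabilityMeasure_map (hX n).aemeasurable
  rw [indepLaw, indepLaw, pair_eq_comp X]
  exact (Measure.map_infinitePi_infinitePi_of_inj (P := fun n => μ.map (X n))
    (injective_pair_iff_ne.2 hij)).symm

theorem iIndepFun_indepLaw (hX : ∀ n, Measurable (X n)) :
    iIndepFun (fun n (x : N → ℝ) => x n) (indepLaw μ X) := by
  have (n : N) : IsProbabilityMeasure (μ.map (X n)) :=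
    Measure.isProbabilityMeasure_map (hX n).aemeasurable
  exact iIndepFun_infinitePi (P := fun n => μ.map (X n)) (X := fun _ t => t)
    fun _ => measurable_id

theorem PSMD.map_pair (hX : ∀ n, Measurable (X n)) {i j : N} (hij : i ≠ j)
    (h : PSMD μ ![X i, X j]) : SmLE ((indepLaw μ X).map fun x k => x (![i, j] k))
      ((law μ X).map fun x k => x (![i, j] k)) := by
  rwa [PSMD, law_pair hX, indepLaw_pair hX hij] at h

theorem PSMD.swap {U V : Ω → ℝ} (hU : Measurable U) (hV : Measurable V) (h : PSMD μ ![U, V]) :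
    PSMD μ ![V, U] := by
  have hUV : ∀ k, Measurable (![U, V] k) := Fin.forall_fin_two.2 ⟨hU, hV⟩
  have := (iIndepFun_indepLaw (μ := μ) hUV).isProbabilityMeasure
  have hswap := SmLE.map_reindex h ![1, 0]
  rwa [← law_pair hUV, ← indepLaw_pair hUV one_ne_zero] at hswap

end Laws

end MarkovTree

open MarkovTree DirTree in
theorem theorem1p3_general {N : Type*} [Countable N] (T : DirTree N)
    (P : Set N) (hP : IsChain T.Anc P)
    (k : N) (hk : T.E T.root k) (hkP : 2 ≤ T.deg T.root → k ∉ P)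
    {Ω Ω' : Type*} [MeasurableSpace Ω] [MeasurableSpace Ω']
    (μ : Measure Ω) [IsProbabilityMeasure μ] (ν : Measure Ω') [IsProbabilityMeasure ν]
    (X : N → Ω → ℝ) (Y : N → Ω' → ℝ)
    (hXm : ∀ n, Measurable (X n)) (hYm : ∀ n, Measurable (Y n))
    (hX : T.IsMarkov (law μ X)) (hY : T.IsMarkov (law ν Y))
    (hXsi : ∀ i j, T.E i j → j ≠ k → StochIncr μ (X j) (X i))
    (hYsi : ∀ i j, T.E i j →
      (j ∉ T.leaves → StochIncr ν (Y i) (Y j)) ∧ (j ∉ P → StochIncr ν (Y j) (Y i))) :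
    ((∀ i j, T.E i j → SmLE (law μ ![X i, X j]) (law ν ![Y i, Y j])) →
      ProcSmLE (law μ X) (law ν Y)) ∧
    ((∀ i j, T.E i j → SmLE (law ν ![Y i, Y j]) (law μ ![X i, X j])) →
      ProcSmLE (law ν Y) (law μ X)) ∧
    (PSMD μ ![X T.root, X k] → ProcPSMD μ X) ∧
    ((∀ i j, T.E i j → j ∈ P → j ∈ T.leaves → PSMD ν ![Y i, Y j]) → ProcPSMD ν Y) := by
  have := isProbabilityMeasure_law (μ := μ) hXm
  have := isProbabilityMeasure_law (μ := ν) hYm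
  have hXY : Comparable T P k (law μ X) (law ν Y) :=
    ⟨hP, hk, hkP, hX, hY, fun i j hij hjk => stochIncr_law hXm (hXsi i j hij hjk),
      fun i j hij hj => stochIncr_law hYm ((hYsi i j hij).1 hj),
      fun i j hij hj => stochIncr_law hYm ((hYsi i j hij).2 hj)⟩
  simp only [law_pair hXm, law_pair hYm]
  refine ⟨hXY.procSmLE, hXY.procSmLE_symm, fun h => ?_, fun h => ?_⟩
  · have hindep := iIndepFun_indepLaw (μ := μ) hXm
    have := hindep.isProbabilityMeasure
    refine (hXY.indep_right hindep).procSmLE_symm fun i j hij => PSMD.map_pair hXm (edge_ne hij) ?_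
    rcases eq_or_ne j k with rfl | hjk
    · rwa [parent_unique hij hk]
    · exact (hXsi i j hij hjk).psmd (hXm i) (hXm j)
  · have hindep := iIndepFun_indepLaw (μ := ν) hYm
    have := hindep.isProbabilityMeasure
    refine (hXY.indep_left hindep).procSmLE fun i j hij => PSMD.map_pair hYm (edge_ne hij) ?_
    by_cases hjP : j ∈ P
    · by_cases hjL : j ∈ T.leaves
      · exact h i j hij hjP hjL
      · exact (((hYsi i j hij).1 hjL).psmd (hYm j) (hYm i)).swap (hYm j) (hYm i)
    · exact ((hYsi i j hij).2 hjP).psmd (hYm i) (hYm j)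

open MarkovTree in
theorem theorem1p3 {N : Type*} [Countable N] (T : DirTree N)
    (P : Set N) (hP : T.IsRootPath P)
    (k : N) (hk : T.E T.root k) (hkP : 2 ≤ T.deg T.root → k ∉ P)
    {Ω Ω' : Type*} [MeasurableSpace Ω] [MeasurableSpace Ω']
    (μ : Measure Ω) [IsProbabilityMeasure μ] (ν : Measure Ω') [IsProbabilityMeasure ν]
    (X : N → Ω → ℝ) (Y : N → Ω' → ℝ)
    (hXm : ∀ n, Measurable (X n)) (hYm : ∀ n, Measurable (Y n))
    (hX : T.IsMarkov (law μ X)) (hY : T.IsMarkov (law ν Y))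
    (hXsi : ∀ i j, T.E i j → j ≠ k → StochIncr μ (X j) (X i))
    (hYsi : ∀ i j, T.E i j →
      (j ∉ T.leaves → StochIncr ν (Y i) (Y j)) ∧ (j ∉ P → StochIncr ν (Y j) (Y i))) :
    ((∀ i j, T.E i j → SmLE (law μ ![X i, X j]) (law ν ![Y i, Y j])) →
      ProcSmLE (law μ X) (law ν Y)) ∧
    ((∀ i j, T.E i j → SmLE (law ν ![Y i, Y j]) (law μ ![X i, X j])) →
      ProcSmLE (law ν Y) (law μ X)) ∧
    (PSMD μ ![X T.root, X k] → ProcPSMD μ X) ∧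
    ((∀ i j, T.E i j → j ∈ P → j ∈ T.leaves → PSMD ν ![Y i, Y j]) → ProcPSMD ν Y) :=
  theorem1p3_general T P hP.isChain k hk hkP μ ν X Y hXm hYm hX hY hXsi hYsi
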